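/- Let $\mathbb{R}^{<\omega}$ be the real vector space of eventually zero real sequences $(x_m)_{m\in\mathbb{N}}$ with the Euclidean norm; identify $\mathbb{R}^n$ with the set of sequences that vanish at all indices $m\ge n$, and let $\mu_n$ be Lebesgue measure on $\mathbb{R}^n$. For a set $X$, let $[X]^{<\omega}$ be the set of its finite subsets. A proper filter $F$ over $[X]^{<\omega}$ is *fine* if $\{z : x\in z\}\in F$ for every $x\in X$. Let $\mathrm{Pow}(\mathbb{R},F)$ be the ring of functions $f:[X]^{<\omega}\to\mathbb{R}$ modulo equality on a set in $F$; it contains $\mathbb{R}$ as the classes of the constants, and $[f]<[g]$ means $\{z: f(z)<g(z)\}\in F$. In it, $a\ll b$ means that $b>0$ and $-b<na<b$ for all $n\in\mathbb{Z}$; $a$ is *infinitesimal* if $a\ll 1$; and $a\approx b$ means that $b$ is invertible and $ab^{-1}-1$ is infinitesimal. For $f:X\to\mathbb{R}$ put $\int f\,dF=\big[z\mapsto \tfrac1{|z|}\sum_{x\in z}f(x)\big]_F$. A *parameterized $k$-dimensional smooth surface* in $\mathbb{R}^N$ is a set $\varphi[U]$, where $U\subseteq V\subseteq\mathbb{R}^k$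 are bounded open sets with $\overline U\subseteq V$, and $\varphi:V\to\mathbb{R}^N$ is injective with $\varphi$ and $\varphi^{-1}$ of class $C^1$. A *measurable fragment* of it is a set $\varphi[B]$ with $B\subseteq U$ Lebesgue measurable, and $\mathrm{vol}_k(\varphi[B])=\int_B\sqrt{\det G_\varphi}\,dx$, where $G_\varphi$ is the Gram matrix of the partial derivatives of $\varphi$. A *$k$-dimensional piecewise smooth surface* $S\subseteq\mathbb{R}^N$ is a finite union of parameterized $k$-dimensional smooth surfaces $S_i$; a set $A\subseteq S$ is a *measurable fragment* of $S$ if, for some such presentation, every $A\cap S_i$ is a measurable fragment of $S_i$ (in particular every Borel $A\subseteq S$ is one). Its volume $\mathrm{vol}_k(A)$ is the sum of the volumes of the pieces in a finite partition of $A$ into measurable fragments of parameterized $k$-dimensional smooth surfaces. A set $A\subseteq\mathbb{R}^{<\omega}$ is *middling* if $\mu_n(A\cap\mathbb{R}^n)<\infty$ for all but finitely many $n$ and $\mu_n(A\cap\mathbb{R}^n)>0$ for infinitely many $n$. **Theorem.** There are a fine filter $\Gamma$ over $[\mathbb{R}^{<\omega}]^{<\omega}$ and a sequence $(\varepsilon_n)_{n\in\mathbb{N}}$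 of positive infinitesimals in $\mathrm{Pow}(\mathbb{R},\Gamma)$ with $\varepsilon_i\ll\varepsilon_j$ whenever $i<j$, such that, writing $m(A)=\int\chi_A\,d\Gamma$ for $A\subseteq\mathbb{R}^{<\omega}$: 1. $\varepsilon_n=m([0,1]^n)$ for every $n\in\mathbb{N}$; 2. for every measurable fragment $A$ of an $n$-dimensional piecewise smooth surface $S\subseteq\mathbb{R}^N$ ($n,N\in\mathbb{N}$), the number $\mathrm{vol}_n(A)$ is well defined (a partition as above exists, and all such partitions give the same real number), and $m(A)=\mathrm{vol}_n(A)\,\varepsilon_n+\delta$ for some $\delta\ll\varepsilon_n$; 3. $m(C)\ll\varepsilon_1$ for every countable $C\subseteq\mathbb{R}^{<\omega}$; 4. $m(A+\vec x)\approx m(A)$ for every middling Borel set $A\subseteq\mathbb{R}^{<\omega}$ and every $\vec x\in\mathbb{R}^{<\omega}$. -/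

import Mathlib

open Filter MeasureTheory

noncomputable section

namespace FilterIntegral

/-! ### The reduced power of `ℝ` by a filter, and its order relations

The reduced power is `Filter.Germ F ℝ`. The strict order is the one that holds pointwise on a set of
the filter. (The strict order attached to the preorder `≤` of germs is a weaker relation unless the
filter is an ultrafilter, so it is not used here.) -/

variable {Z : Type*} {F : Filter Z}

/-- `[f] < [g]` iff `{z | f z < g z} ∈ F`. -/
def RPLt (a b : F.Germ ℝ) : Prop := Germ.LiftRel (· < ·) a b

/-- `a ≪ b`: `b > 0`, and `-b < n a < b` for all integers `n`. -/
def MuchLess (a b : F.Germ ℝ) : Prop :=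
  RPLt 0 b ∧ ∀ n : ℤ, RPLt (-b) (n • a) ∧ RPLt (n • a) b

/-- `a` is infinitesimal: `a ≪ 1`. -/
def Infinitesimal (a : F.Germ ℝ) : Prop := MuchLess a 1

/-- `a ∼ b`: the difference is infinitesimal. -/
def InfClose (a b : F.Germ ℝ) : Prop := Infinitesimal (a - b)

/-- `a ≈ b`: `b` is invertible and `a b⁻¹ ∼ 1`. -/
def RatioClose (a b : F.Germ ℝ) : Prop :=
  ∃ c : F.Germ ℝ, b * c = 1 ∧ InfClose (a * c) 1

/-! ### Fine filters and the filter integral -/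

variable {X : Type*}

/-- A fine filter over the finite subsets of `X`: a proper filter that contains
`{z | x ∈ z}` for every `x`. -/
def IsFine (F : Filter (Finset X)) : Prop := F.NeBot ∧ ∀ x : X, {z : Finset X | x ∈ z} ∈ F

/-- `∫ f dF`, the class of `z ↦ (∑ x ∈ z, f x) / |z|`. -/
def filterIntegral (F : Filter (Finset X)) (f : X → ℝ) : F.Germ ℝ :=
  ((fun z : Finset X => (∑ x ∈ z, f x) / (z.card : ℝ) : Finset X → ℝ) : F.Germ ℝ)

/-- `∫ χ_A dF`. -/
def filterMeasure (F : Filter (Finset X)) (A : Set X) : F.Germ ℝ :=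
  filterIntegral F (A.indicator fun _ => (1 : ℝ))

/-! ### The space of eventually zero real sequences -/

/-- The eventually zero real sequences with the Euclidean norm, as a subspace of `ℓ²`. -/
def FinSeq : Submodule ℝ (lp (fun _ : ℕ => ℝ) 2) where
  carrier := {x | ∃ n : ℕ, ∀ m, n ≤ m → x m = 0}
  zero_mem' := ⟨0, fun _ _ => rfl⟩
  add_mem' := by
    rintro x y ⟨n, hn⟩ ⟨k, hk⟩
    refine ⟨max n k, fun m hm => ?_⟩
    have h1 := hn m (le_trans (le_max_left _ _) hm)
    have h2 := hk m (le_trans (le_max_right _ _) hm)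
    rw [lp.coeFn_add, Pi.add_apply, h1, h2, add_zero]
  smul_mem' := by
    rintro c x ⟨n, hn⟩
    refine ⟨n, fun m hm => ?_⟩
    rw [lp.coeFn_smul, Pi.smul_apply, hn m hm, smul_zero]

/-- The sequence that continues a vector of `ℝⁿ` by zeros. -/
def padSeq {n : ℕ} (x : EuclideanSpace ℝ (Fin n)) (m : ℕ) : ℝ :=
  if h : m < n then x ⟨m, h⟩ else 0

theorem padSeq_eq_zero {n : ℕ} (x : EuclideanSpace ℝ (Fin n)) {m : ℕ} (h : n ≤ m) :
    padSeq x m = 0 := by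
  rw [padSeq, dif_neg (not_lt.mpr h)]

theorem padSeq_memℓp {n : ℕ} (x : EuclideanSpace ℝ (Fin n)) :
    Memℓp (E := fun _ : ℕ => ℝ) (padSeq x) 2 := by
  apply memℓp_gen
  refine summable_of_ne_finset_zero (s := Finset.range n) fun m hm => ?_
  rw [padSeq_eq_zero x (by simpa using hm)]
  simp

/-- The canonical inclusion `ℝⁿ ⊆ ℝ^{<ω}`. -/
def incl (n : ℕ) (x : EuclideanSpace ℝ (Fin n)) : FinSeq :=
  ⟨⟨padSeq x, padSeq_memℓp x⟩, n, fun _ hm => padSeq_eq_zero x hm⟩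

/-- The cube `[0,1]ⁿ` in `ℝ^{<ω}`. -/
def unitCube (n : ℕ) : Set FinSeq :=
  incl n '' {x | ∀ i, x i ∈ Set.Icc (0 : ℝ) 1}

/-- `A` is middling: `A ∩ ℝⁿ` has finite Lebesgue measure for all but finitely many `n`, and
positive Lebesgue measure for infinitely many `n`. -/
def Middling (A : Set FinSeq) : Prop :=
  {n : ℕ | ¬ volume (incl n ⁻¹' A) < ⊤}.Finite ∧ {n : ℕ | 0 < volume (incl n ⁻¹' A)}.Infinite

/-! ### Surfaces, measurable fragments and their volume -/

/-- A parameterization `φ : U → φ[U]` of a `k`-dimensional smooth surface in `ℝᴺ`: `φ` and its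
inverse are `C¹` on `V` and `φ[V]`, where the bounded open set `V` contains the closure of `U`. -/
structure SmoothParam (k N : ℕ) where
  φ : EuclideanSpace ℝ (Fin k) → EuclideanSpace ℝ (Fin N)
  U : Set (EuclideanSpace ℝ (Fin k))
  V : Set (EuclideanSpace ℝ (Fin k))
  isOpen_U : IsOpen U
  isOpen_V : IsOpen V
  bounded_U : Bornology.IsBounded U
  bounded_V : Bornology.IsBounded V
  closure_subset : closure U ⊆ V
  injOn : Set.InjOn φ V
  contDiffOn : ContDiffOn ℝ 1 φ V
  contDiffOn_inv : ContDiffOn ℝ 1 (Function.invFunOn φ V) (φ '' V)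

variable {k N : ℕ}

/-- The parameterized surface `φ[U]`. -/
def SmoothParam.surface (P : SmoothParam k N) : Set (EuclideanSpace ℝ (Fin N)) := P.φ '' P.U

/-- The Gram matrix of the partial derivatives of `φ` at `x`. -/
def SmoothParam.gramMatrix (P : SmoothParam k N) (x : EuclideanSpace ℝ (Fin k)) :
    Matrix (Fin k) (Fin k) ℝ :=
  Matrix.gram ℝ fun i : Fin k => fderiv ℝ P.φ x (EuclideanSpace.single i 1)

/-- The volume `∫_B √(det G_φ)` of `φ[B]`, for measurable `B ⊆ U`. -/
def SmoothParam.paramVol (P : SmoothParam k N) (B : Set (EuclideanSpace ℝ (Fin k))) : ℝ :=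
  ∫ x in B, Real.sqrt (P.gramMatrix x).det

/-- `A` is a measurable fragment of the parameterized surface: `A = φ[B]` with `B ⊆ U` Lebesgue
measurable. -/
def SmoothParam.IsFragment (P : SmoothParam k N) (A : Set (EuclideanSpace ℝ (Fin N))) : Prop :=
  ∃ B ⊆ P.U, NullMeasurableSet B volume ∧ A = P.φ '' B

/-- `A` is a measurable fragment of the `k`-dimensional piecewise smooth surface `S`: the set `S` is
a finite union of parameterized surfaces, and `A ⊆ S` meets each of them in a measurable fragment. -/
def IsPiecewiseFragment (k : ℕ) (S A : Set (EuclideanSpace ℝ (Fin N))) : Prop :=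
  A ⊆ S ∧ ∃ (r : ℕ) (P : Fin r → SmoothParam k N),
    S = ⋃ i, (P i).surface ∧ ∀ i, (P i).IsFragment (A ∩ (P i).surface)

/-- `v` is the total volume of some partition of `A` into finitely many measurable fragments of
`k`-dimensional parameterized surfaces. -/
def IsVol (k : ℕ) (A : Set (EuclideanSpace ℝ (Fin N))) (v : ℝ) : Prop :=
  ∃ (r : ℕ) (P : Fin r → SmoothParam k N) (B : Fin r → Set (EuclideanSpace ℝ (Fin k))),
    (∀ i, B i ⊆ (P i).U ∧ NullMeasurableSet (B i) volume) ∧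
    (∀ i j, i ≠ j → Disjoint ((P i).φ '' B i) ((P j).φ '' B j)) ∧
    A = ⋃ i, (P i).φ '' B i ∧ v = ∑ i, (P i).paramVol (B i)

end FilterIntegral

end

/-!
The filter is the image of `atTop` on a directed set of finite lists of requirements, under a choice
of finite sets that meet them. So the proof consists in finding, for finitely many points,
fragments, countable sets and translated middling sets, one finite set `z` that contains the points
and counts the sets correctly up to a relative error `η`.

For each dimension `n ≥ 1` up to a bound `D`, take a finite measure `ν n` on `ℝ^{<ω}`. In low
dimensions it is the `n`-dimensional volume carried by the union of the unit cube and the given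
`n`-dimensional surfaces. In dimensions beyond those of the surfaces, once `ℝⁿ` contains the
translation vectors and meets the middling sets in finite measure, it is Lebesgue measure on the
part of `ℝⁿ` covered by the middling sets and their translates; in between it is zero. A finite
measure without atoms can be sampled: in each atom of the Boolean algebra generated by the sets of
interest choose a number of points proportional to its measure, rounded down, so that null sets
receive no point (`exists_sample`). The union `z` of such samples, each much larger than all the
preceding ones, counts a set according to the last `ν n` for which it is not null
(`exists_layered_sample`). Surfaces of dimension less than `n` and countable sets are null for
`ν n`, which gives the comparisons between the infinitesimals `ε n`. A middling set and its
translate have the same finite Lebesgue measure in the last dimension up to `D` in which they are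
not null, hence almost the same count (`exists_good_finset`).

The volume on a union of surfaces exists because two parameterizations induce the same measure on
their common part (`Patch.meas_eq_of_subset`). This is the change of variables formula for the
transition map, whose domain is only a Borel set; at almost every point of it, the tangent
directions to the set span, so that the derivatives satisfy the chain rule there
(`ae_derivWithin_eq_zero`). The glued volume computes the sum of volumes over any partition, so this
sum is well defined (`IsVol.unique`). In dimension zero fineness alone makes all counts exact
(`Frag.count_zero`).
-/

noncomputable section

namespace FilterIntegral

open scoped Topology ENNReal

/-! ### The embeddings `ℝⁿ → ℝ^{<ω}` and the restrictions `ℝ^{<ω} → ℝⁿ` -/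

/-- Euclidean space of dimension `k`. -/
abbrev Euc (k : ℕ) : Type := EuclideanSpace ℝ (Fin k)

instance : MeasurableSpace FinSeq := borel FinSeq
instance : BorelSpace FinSeq := ⟨rfl⟩

theorem coord_incl {n : ℕ} (x : Euc n) (m : ℕ) : (incl n x).1 m = padSeq x m := rfl

theorem padSeq_fin {n : ℕ} (x : Euc n) (i : Fin n) : padSeq x i = x i := by
  simp [padSeq]

theorem FinSeq.ext_coord {x y : FinSeq} (h : ∀ m, x.1 m = y.1 m) : x = y :=
  Subtype.ext (lp.ext (funext h))

/-- The `m`-th coordinate, as a continuous linear functional on `ℝ^{<ω}`. -/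
def coordL (m : ℕ) : FinSeq →L[ℝ] ℝ :=
  LinearMap.mkContinuous
    { toFun := fun x => x.1 m
      map_add' := fun _ _ => rfl
      map_smul' := fun _ _ => rfl } 1 fun x => by
    rw [one_mul]
    exact lp.norm_apply_le_norm (E := fun _ : ℕ => ℝ) (p := 2) (by norm_num) x.1 m

@[simp] theorem coordL_apply (m : ℕ) (x : FinSeq) : coordL m x = x.1 m := rfl

/-- The map `ℝ^{<ω} → ℝⁿ` that keeps the first `n` coordinates. -/
def restr (n : ℕ) : FinSeq →L[ℝ] Euc n :=
  (PiLp.continuousLinearEquiv 2 ℝ fun _ : Fin n => ℝ).symm.toContinuousLinearMap.comp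
    (ContinuousLinearMap.pi fun i : Fin n => coordL i)

@[simp] theorem restr_apply (n : ℕ) (x : FinSeq) (i : Fin n) : restr n x i = x.1 i := rfl

/-- The canonical inclusion `ℝⁿ ⊆ ℝ^{<ω}` as a linear isometry. -/
def inclL (n : ℕ) : Euc n →ₗᵢ[ℝ] FinSeq :=
  LinearMap.isometryOfInner
    { toFun := incl n
      map_add' := fun x y => FinSeq.ext_coord fun m => by
        change padSeq (x + y) m = padSeq x m + padSeq y m
        unfold padSeq; split <;> simp
      map_smul' := fun c x => FinSeq.ext_coord fun m => by
        change padSeq (c • x) m = c * padSeq x m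
        unfold padSeq; split <;> simp }
    fun x y => by
      change inner ℝ (incl n x).1 (incl n y).1 = inner ℝ x y
      rw [lp.inner_eq_tsum, tsum_eq_sum (s := Finset.range n), ← Fin.sum_univ_eq_sum_range
        (fun i => inner ℝ ((incl n x).1 i) ((incl n y).1 i)), PiLp.inner_apply]
      · simp only [coord_incl, padSeq_fin]
      · intro m hm
        rw [coord_incl, padSeq_eq_zero x (by simpa using hm), inner_zero_left]

@[simp] theorem inclL_apply (n : ℕ) (x : Euc n) : inclL n x = incl n x := rfl

@[simp] theorem restr_incl (n : ℕ) (x : Euc n) : restr n (incl n x) = x := by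
  ext i
  rw [restr_apply, coord_incl, padSeq_fin]

theorem incl_injective (n : ℕ) : Function.Injective (incl n) :=
  Function.LeftInverse.injective (restr_incl n)

theorem continuous_incl (n : ℕ) : Continuous (incl n) := (inclL n).continuous

theorem mem_range_incl {n : ℕ} {x : FinSeq} :
    x ∈ Set.range (incl n) ↔ ∀ m, n ≤ m → x.1 m = 0 := by
  constructor
  · rintro ⟨y, rfl⟩ m hm
    exact padSeq_eq_zero y hm
  · intro h
    refine ⟨restr n x, FinSeq.ext_coord fun m => ?_⟩
    rw [coord_incl]
    by_cases hm : m < n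
    · exact padSeq_fin (restr n x) ⟨m, hm⟩
    · rw [padSeq_eq_zero _ (not_lt.mp hm), h m (not_lt.mp hm)]

theorem range_incl_mono {n m : ℕ} (h : n ≤ m) : Set.range (incl n) ⊆ Set.range (incl m) :=
  fun _ hx => mem_range_incl.2 fun i hi => mem_range_incl.1 hx i (h.trans hi)

theorem exists_mem_range_incl (x : FinSeq) : ∃ n, x ∈ Set.range (incl n) := by
  obtain ⟨n, hn⟩ := x.2
  exact ⟨n, mem_range_incl.2 hn⟩

theorem incl_zero (n : ℕ) : incl n 0 = 0 := (inclL n).map_zero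

theorem zero_mem_unitCube (n : ℕ) : (0 : FinSeq) ∈ unitCube n :=
  ⟨0, fun i => by simp, incl_zero n⟩

/-! ### Jacobians of linear maps and of differentiable maps on arbitrary sets -/

section Jacobian

variable {H : Type*} [NormedAddCommGroup H] [InnerProductSpace ℝ H] {k : ℕ}

/-- The factor by which a linear map multiplies `k`-dimensional volume: the square root of the Gram
determinant of the images of the standard basis vectors. -/
def jac (T : Euc k →L[ℝ] H) : ℝ :=
  Real.sqrt (Matrix.gram ℝ fun i : Fin k => T (EuclideanSpace.single i 1)).det

theorem continuous_jac : Continuous (jac : (Euc k →L[ℝ] H) → ℝ) := by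
  unfold jac
  refine Real.continuous_sqrt.comp (Continuous.matrix_det ?_)
  refine continuous_matrix fun i j => ?_
  simp only [Matrix.gram_apply]
  fun_prop

theorem jac_isometry_comp {H' : Type*} [NormedAddCommGroup H'] [InnerProductSpace ℝ H']
    (L : H →ₗᵢ[ℝ] H') (T : Euc k →L[ℝ] H) :
    jac (L.toContinuousLinearMap.comp T) = jac T := by
  unfold jac
  congr 2
  ext i j
  simp [Matrix.gram_apply]

theorem jac_isometry (L : Euc k →ₗᵢ[ℝ] H) : jac L.toContinuousLinearMap = 1 := by
  have : (Matrix.gram ℝ fun i : Fin k =>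
      L.toContinuousLinearMap (EuclideanSpace.single i 1)) = 1 := by
    ext i j
    simp [Matrix.gram_apply, Matrix.one_apply, EuclideanSpace.inner_single_left]
  rw [jac, this, Matrix.det_one, Real.sqrt_one]

/-- Multiplicativity of the Jacobian. -/
theorem jac_comp (T : Euc k →L[ℝ] H) (A : Euc k →L[ℝ] Euc k) :
    jac (T.comp A) = |A.det| * jac T := by
  set b := (EuclideanSpace.basisFun (Fin k) ℝ).toBasis with hb
  set M := LinearMap.toMatrix b b A.toLinearMap with hM
  have hA : ∀ i, A (EuclideanSpace.single i 1) = ∑ a, M a i • EuclideanSpace.single a (1 : ℝ) := by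
    intro i
    have := b.sum_repr (A (EuclideanSpace.single i 1))
    rw [← this]
    simp [hM, hb, LinearMap.toMatrix_apply]
  have hgram : (Matrix.gram ℝ fun i : Fin k => (T.comp A) (EuclideanSpace.single i 1)) =
      M.transpose * (Matrix.gram ℝ fun i : Fin k => T (EuclideanSpace.single i 1)) * M := by
    ext i j
    simp only [Matrix.gram_apply, ContinuousLinearMap.comp_apply, hA, map_sum, map_smul,
      Matrix.mul_apply, Matrix.transpose_apply, sum_inner, inner_sum, inner_smul_left,
      inner_smul_right]
    simp
    exact Finset.sum_congr rfl fun c _ => mul_comm _ _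
  have hdet : M.det = A.det := by
    rw [hM, LinearMap.det_toMatrix]
  rw [jac, hgram, Matrix.det_mul, Matrix.det_mul, Matrix.det_transpose, hdet, jac,
    show ∀ d g : ℝ, d * g * d = d ^ 2 * g by intros; ring, Real.sqrt_mul (sq_nonneg _),
    Real.sqrt_sq_eq_abs]

end Jacobian

/-- At almost every point of `B` the tangent directions to `B` span `ℝᵏ`. Hence a map that vanishes
on `B` has zero derivative within `B` at almost every point of `B`. -/
theorem ae_derivWithin_eq_zero {k : ℕ} {B : Set (Euc k)} (hB : MeasurableSet B)
    {h : Euc k → FinSeq} {h' : Euc k → Euc k →L[ℝ] FinSeq} (h0 : ∀ x ∈ B, h x = 0)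
    (hd : ∀ x ∈ B, HasFDerivWithinAt h (h' x) B x) :
    ∀ᵐ x ∂(volume.restrict B), h' x = 0 := by
  rcases Nat.eq_zero_or_pos k with rfl | hk
  · exact Eventually.of_forall fun x => ContinuousLinearMap.ext fun v => by
      rw [Subsingleton.elim v 0, map_zero, map_zero]
  set e : Euc k := EuclideanSpace.single ⟨0, hk⟩ 1 with he
  -- the estimate is available for maps `ℝᵏ → ℝᵏ`, so it is applied to each coordinate times `e`
  have key : ∀ m : ℕ, ∀ᵐ x ∂(volume.restrict B),
      (((coordL m).smulRight e).comp (h' x)) = 0 := by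
    intro m
    have happ : ApproximatesLinearOn (fun x => ((coordL m).smulRight e) (h x))
        (0 : Euc k →L[ℝ] Euc k) B 0 := by
      intro x hx y hy
      simp [h0 x hx, h0 y hy]
    filter_upwards [happ.norm_fderiv_sub_le volume hB
      (fun x => ((coordL m).smulRight e).comp (h' x))
      fun x hx => ((coordL m).smulRight e).hasFDerivAt.comp_hasFDerivWithinAt x (hd x hx)]
      with x hx
    simpa using hx
  filter_upwards [ae_all_iff.2 key] with x hx
  ext v : 1
  refine FinSeq.ext_coord fun m => ?_
  have h1 := congrArg (fun T : Euc k →L[ℝ] Euc k => T v ⟨0, hk⟩) (hx m)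
  simpa [he] using h1

/-! ### Patches and their volume measures -/

/-- A `k`-dimensional patch in `ℝ^{<ω}`: a parameterization `f` of a set by a Borel set `U ⊆ ℝᵏ`,
continuously differentiable within `U` with derivative `f'`, together with a left inverse that is
differentiable within the image. The domain may be unbounded and need not be open, so that `ℝᵏ`
itself, and its Borel subsets, are patches. -/
structure Patch (k : ℕ) where
  f : Euc k → FinSeq
  f' : Euc k → Euc k →L[ℝ] FinSeq
  U : Set (Euc k)
  inv : FinSeq → Euc k
  measU : MeasurableSet U
  hasDeriv : ∀ x ∈ U, HasFDerivWithinAt f (f' x) U x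
  contDeriv : ContinuousOn f' U
  leftInv : ∀ x ∈ U, inv (f x) = x
  diffInv : DifferentiableOn ℝ inv (f '' U)

namespace Patch

variable {k n : ℕ}

/-- The set parameterized by a patch. -/
def surface (P : Patch k) : Set FinSeq := P.f '' P.U

/-- The `k`-dimensional volume on a patch, as a Borel measure on `ℝ^{<ω}`. -/
def meas (P : Patch k) : Measure FinSeq :=
  ((volume.restrict P.U).withDensity fun x => ENNReal.ofReal (jac (P.f' x))).map P.f

theorem continuousOn (P : Patch k) : ContinuousOn P.f P.U :=
  fun x hx => (P.hasDeriv x hx).continuousWithinAt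

theorem injOn (P : Patch k) : Set.InjOn P.f P.U := fun x hx y hy h => by
  rw [← P.leftInv x hx, h, P.leftInv y hy]

theorem measurableSet_preimage (P : Patch k) {E : Set FinSeq} (hE : MeasurableSet E) :
    MeasurableSet (P.U ∩ P.f ⁻¹' E) := by
  have h := ((continuousOn_iff_continuous_domRestrict.1 P.continuousOn).measurable hE)
  have h2 := P.measU.subtype_image h
  convert h2 using 1
  ext x
  simp [and_comm]

theorem measurableSet_image (P : Patch k) {B : Set (Euc k)} (hB : MeasurableSet B)
    (hBU : B ⊆ P.U) : MeasurableSet (P.f '' B) :=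
  hB.image_of_continuousOn_injOn (P.continuousOn.mono hBU) (P.injOn.mono hBU)

theorem measurableSet_surface (P : Patch k) : MeasurableSet P.surface :=
  P.measurableSet_image P.measU subset_rfl

theorem meas_apply (P : Patch k) {E : Set FinSeq} (hE : MeasurableSet E) :
    P.meas E = ∫⁻ x in P.U ∩ P.f ⁻¹' E, ENNReal.ofReal (jac (P.f' x)) := by
  have hf : AEMeasurable P.f
      ((volume.restrict P.U).withDensity fun x => ENNReal.ofReal (jac (P.f' x))) :=
    (P.continuousOn.aemeasurable P.measU).mono_ac (withDensity_absolutelyContinuous _ _)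
  have hU : ((volume.restrict P.U).withDensity fun x => ENNReal.ofReal (jac (P.f' x))) P.Uᶜ = 0 :=
    withDensity_absolutelyContinuous _ _ (by
      rw [Measure.restrict_apply P.measU.compl, Set.compl_inter_self, measure_empty])
  rw [meas, Measure.map_apply_of_aemeasurable hf hE]
  have h1 : ((volume.restrict P.U).withDensity fun x => ENNReal.ofReal (jac (P.f' x))) (P.f ⁻¹' E)
      = ((volume.restrict P.U).withDensity fun x => ENNReal.ofReal (jac (P.f' x)))
        (P.U ∩ P.f ⁻¹' E) := by
    refine le_antisymm ?_ (measure_mono Set.inter_subset_right)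
    calc _ ≤ _ := measure_mono (show P.f ⁻¹' E ⊆ (P.U ∩ P.f ⁻¹' E) ∪ P.Uᶜ from fun x hx => by
            by_cases h : x ∈ P.U
            · exact Or.inl ⟨h, hx⟩
            · exact Or.inr h)
      _ ≤ _ := measure_union_le _ _
      _ = _ := by rw [hU, add_zero]
  rw [h1, withDensity_apply _ (P.measurableSet_preimage hE),
    Measure.restrict_restrict (P.measurableSet_preimage hE),
    Set.inter_eq_left.2 Set.inter_subset_left]

theorem preimage_image (P : Patch k) {B : Set (Euc k)} (hBU : B ⊆ P.U) :
    P.U ∩ P.f ⁻¹' (P.f '' B) = B := by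
  ext x
  constructor
  · rintro ⟨hx, y, hy, hxy⟩
    rwa [← P.injOn (hBU hy) hx hxy]
  · exact fun hx => ⟨hBU hx, x, hx, rfl⟩

theorem meas_image_of_measurable (P : Patch k) {B : Set (Euc k)} (hB : MeasurableSet B)
    (hBU : B ⊆ P.U) : P.meas (P.f '' B) = ∫⁻ x in B, ENNReal.ofReal (jac (P.f' x)) := by
  rw [P.meas_apply (P.measurableSet_image hB hBU), P.preimage_image hBU]

theorem meas_image_of_null (P : Patch k) {B : Set (Euc k)} (hB : volume B = 0)
    (hBU : B ⊆ P.U) : P.meas (P.f '' B) = 0 := by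
  have h0 : volume (toMeasurable volume B ∩ P.U) = 0 :=
    measure_mono_null Set.inter_subset_left (by rwa [measure_toMeasurable])
  refine measure_mono_null (Set.image_mono (Set.subset_inter (subset_toMeasurable volume B) hBU)) ?_
  rw [P.meas_image_of_measurable ((measurableSet_toMeasurable _ _).inter P.measU)
    Set.inter_subset_right, Measure.restrict_eq_zero.2 h0, lintegral_zero_measure]

/-- `B` splits into a Borel set, whose image is Borel by the Lusin–Souslin theorem, and a null set,
whose image is null. -/
theorem nullMeasurableSet_image (P : Patch k) {B : Set (Euc k)} (hB : NullMeasurableSet B volume)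
    (hBU : B ⊆ P.U) : NullMeasurableSet (P.f '' B) P.meas := by
  obtain ⟨B₀, h₀, hm, hae⟩ := hB.exists_measurable_subset_ae_eq
  have hz : volume (B \ B₀) = 0 := (ae_le_set.1 hae.symm.le)
  rw [← Set.union_sdiff_cancel h₀, Set.image_union]
  exact (P.measurableSet_image hm (h₀.trans hBU)).nullMeasurableSet.union
    (NullMeasurableSet.of_null (P.meas_image_of_null hz (Set.sdiff_subset.trans hBU)))

theorem meas_image (P : Patch k) {B : Set (Euc k)} (hB : NullMeasurableSet B volume)
    (hBU : B ⊆ P.U) : P.meas (P.f '' B) = ∫⁻ x in B, ENNReal.ofReal (jac (P.f' x)) := by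
  obtain ⟨B₀, h₀, hm, hae⟩ := hB.exists_measurable_subset_ae_eq
  have hz : volume (B \ B₀) = 0 := (ae_le_set.1 hae.symm.le)
  rw [← Measure.restrict_congr_set hae, ← P.meas_image_of_measurable hm (h₀.trans hBU)]
  refine le_antisymm ?_ (measure_mono (Set.image_mono h₀))
  conv_lhs => rw [← Set.union_sdiff_cancel h₀, Set.image_union]
  refine (measure_union_le _ _).trans ?_
  rw [P.meas_image_of_null hz (Set.sdiff_subset.trans hBU), add_zero]

theorem meas_compl_surface (P : Patch k) : P.meas P.surfaceᶜ = 0 := by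
  rw [P.meas_apply P.measurableSet_surface.compl]
  have : P.U ∩ P.f ⁻¹' P.surfaceᶜ = ∅ := by
    ext x
    simp only [Set.mem_inter_iff, Set.mem_preimage, Set.mem_compl_iff, Set.mem_empty_iff_false,
      iff_false, not_and, not_not]
    exact fun hx => ⟨x, hx, rfl⟩
  rw [this, Measure.restrict_empty, lintegral_zero_measure]

theorem meas_restrict_surface (P : Patch k) : P.meas.restrict P.surface = P.meas :=
  Measure.restrict_eq_self_of_ae_mem (by
    rw [ae_iff]; exact P.meas_compl_surface)

/-- The derivative of the transition map `Q.inv ∘ P.f` between two patches, at parameters of common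
points. -/
theorem hasFDerivWithinAt_transition {l : ℕ} (P : Patch k) (Q : Patch l) {B : Set (Euc k)}
    (hB : B ⊆ P.U) (hBQ : ∀ x ∈ B, P.f x ∈ Q.surface) {x : Euc k} (hx : x ∈ B) :
    HasFDerivWithinAt (fun x => Q.inv (P.f x))
      ((fderivWithin ℝ Q.inv Q.surface (P.f x)).comp (P.f' x)) B x :=
  ((Q.diffInv (P.f x) (hBQ x hx)).hasFDerivWithinAt).comp x
    ((P.hasDeriv x (hB hx)).mono hB) (fun y hy => hBQ y hy)

/-- Volume on a surface does not depend on the parameterization. -/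
theorem meas_eq_of_subset (P Q : Patch k) {E : Set FinSeq} (hE : MeasurableSet E)
    (hP : E ⊆ P.surface) (hQ : E ⊆ Q.surface) : P.meas E = Q.meas E := by
  set B := P.U ∩ P.f ⁻¹' E with hBdef
  set g : Euc k → Euc k := fun x => Q.inv (P.f x) with hg
  set g' : Euc k → Euc k →L[ℝ] Euc k :=
    fun x => (fderivWithin ℝ Q.inv Q.surface (P.f x)).comp (P.f' x) with hg'
  have hBm : MeasurableSet B := P.measurableSet_preimage hE
  have hBU : B ⊆ P.U := Set.inter_subset_left
  have hBQ : ∀ x ∈ B, P.f x ∈ Q.surface := fun x hx => hQ hx.2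
  have hgd : ∀ x ∈ B, HasFDerivWithinAt g (g' x) B x := fun x hx =>
    P.hasFDerivWithinAt_transition Q hBU hBQ hx
  have hgU : ∀ x ∈ B, g x ∈ Q.U ∧ Q.f (g x) = P.f x := by
    intro x hx
    obtain ⟨y, hy, hyx⟩ := hBQ x hx
    have : g x = y := by rw [hg]; simp only; rw [← hyx, Q.leftInv y hy]
    rw [this]
    exact ⟨hy, hyx⟩
  have hgi : Set.InjOn g B := fun x hx y hy hxy => P.injOn (hBU hx) (hBU hy) (by
    rw [← (hgU x hx).2, ← (hgU y hy).2, hxy])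
  have himg : g '' B = Q.U ∩ Q.f ⁻¹' E := by
    ext y
    constructor
    · rintro ⟨x, hx, rfl⟩
      exact ⟨(hgU x hx).1, by rw [Set.mem_preimage, (hgU x hx).2]; exact hx.2⟩
    · rintro ⟨hy, hyE⟩
      obtain ⟨x, hx, hxy⟩ := hP hyE
      refine ⟨x, ⟨hx, by rw [Set.mem_preimage, hxy]; exact hyE⟩, ?_⟩
      rw [hg]; simp only; rw [hxy, Q.leftInv y hy]
  have hae : ∀ᵐ x ∂(volume.restrict B), P.f' x = (Q.f' (g x)).comp (g' x) := by
    have := ae_derivWithin_eq_zero hBm (h := fun x => P.f x - Q.f (g x))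
      (h' := fun x => P.f' x - (Q.f' (g x)).comp (g' x))
      (fun x hx => by rw [(hgU x hx).2, sub_self])
      (fun x hx => ((P.hasDeriv x (hBU hx)).mono hBU).sub
        ((Q.hasDeriv (g x) (hgU x hx).1).comp x (hgd x hx) fun y hy => (hgU y hy).1))
    filter_upwards [this] with x hx
    exact sub_eq_zero.1 hx
  rw [P.meas_apply hE, Q.meas_apply hE, ← himg,
    lintegral_image_eq_lintegral_abs_det_fderiv_mul volume hBm hgd hgi]
  refine lintegral_congr_ae ?_
  filter_upwards [hae] with x hx
  rw [hx, jac_comp, ENNReal.ofReal_mul (abs_nonneg _)]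

theorem meas_restrict_comm (P Q : Patch k) :
    P.meas.restrict Q.surface = Q.meas.restrict P.surface := by
  have key : ∀ P Q : Patch k, ∀ E, MeasurableSet E → P.meas.restrict Q.surface E =
      P.meas (E ∩ (P.surface ∩ Q.surface)) := by
    intro P Q E hE
    conv_lhs => rw [← P.meas_restrict_surface]
    rw [Measure.restrict_restrict Q.measurableSet_surface, Measure.restrict_apply hE,
      Set.inter_comm Q.surface]
  ext E hE
  rw [key P Q E hE, key Q P E hE, Set.inter_comm Q.surface]
  exact P.meas_eq_of_subset Q
    (hE.inter (P.measurableSet_surface.inter Q.measurableSet_surface))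
    (fun x hx => hx.2.1) (fun x hx => hx.2.2)

/-- A patch of lower dimension is a null set: seen in the parameters of the other patch, it is the
image of a map into `ℝⁿ` that factors through `ℝᵏ`. -/
theorem meas_surface_of_lt (h : k < n) (P : Patch n) (Q : Patch k) : P.meas Q.surface = 0 := by
  set C := Q.U ∩ Q.f ⁻¹' P.surface with hC
  set π : Euc n →L[ℝ] Euc k := (restr k).comp (inclL n).toContinuousLinearMap with hπ
  have hπs : ∀ y : Euc k, ∃ x : Euc n, π x = y := by
    intro y
    obtain ⟨x, hx⟩ := range_incl_mono h.le ⟨y, rfl⟩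
    exact ⟨x, by simp [hπ, hx]⟩
  have hsub : P.U ∩ P.f ⁻¹' Q.surface ⊆ (fun x => P.inv (Q.f (π x))) '' (π ⁻¹' C) := by
    rintro x ⟨hx, y, hy, hyx⟩
    obtain ⟨w, hw⟩ := hπs y
    refine ⟨w, ?_, ?_⟩
    · rw [Set.mem_preimage, hw]
      exact ⟨hy, by rw [Set.mem_preimage, hyx]; exact ⟨x, hx, rfl⟩⟩
    · simp only [hw, hyx, P.leftInv x hx]
  have hz : volume (P.U ∩ P.f ⁻¹' Q.surface) = 0 := by
    refine measure_mono_null hsub ?_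
    refine addHaar_image_eq_zero_of_det_fderivWithin_eq_zero volume
      (f' := fun x => ((fderivWithin ℝ P.inv P.surface (Q.f (π x))).comp (Q.f' (π x))).comp π)
      ?_ ?_
    · intro x hx
      exact (Q.hasFDerivWithinAt_transition P Set.inter_subset_left (fun y hy => hy.2) hx).comp x
        π.hasFDerivAt.hasFDerivWithinAt (fun y hy => hy)
    · intro x _
      have hker : ∃ v, v ≠ 0 ∧ π v = 0 := by
        have : ¬ Function.Injective π.toLinearMap := fun hi => by
          have := LinearMap.finrank_le_finrank_of_injective hi
          simp at this
          omega
        rw [← LinearMap.ker_eq_bot, Submodule.eq_bot_iff] at this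
        push Not at this
        obtain ⟨v, hv, hv0⟩ := this
        exact ⟨v, hv0, hv⟩
      obtain ⟨v, hv0, hv⟩ := hker
      refine LinearMap.det_eq_zero_iff_ker_ne_bot.2 fun hb => hv0 ?_
      refine (Submodule.eq_bot_iff _).1 hb v ?_
      simp [hv]
  rw [P.meas_apply Q.measurableSet_surface, Measure.restrict_eq_zero.2 hz, lintegral_zero_measure]

theorem meas_singleton (P : Patch k) (hk : 0 < k) (y : FinSeq) : P.meas {y} = 0 := by
  have : Nonempty (Fin k) := ⟨⟨0, hk⟩⟩
  rw [P.meas_apply (measurableSet_singleton y)]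
  have : volume (P.U ∩ P.f ⁻¹' {y}) = 0 :=
    Set.Subsingleton.measure_zero (fun a ha b hb => P.injOn ha.1 hb.1 (ha.2.trans hb.2.symm)) _
  rw [Measure.restrict_eq_zero.2 this, lintegral_zero_measure]

/-- A Borel subset of `ℝⁿ`, as a patch in `ℝ^{<ω}`. -/
def flat (n : ℕ) (U : Set (Euc n)) (hU : MeasurableSet U) : Patch n where
  f := incl n
  f' := fun _ => (inclL n).toContinuousLinearMap
  U := U
  inv := restr n
  measU := hU
  hasDeriv := fun _ _ => (inclL n).toContinuousLinearMap.hasFDerivAt.hasFDerivWithinAt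
  contDeriv := continuousOn_const
  leftInv := fun x _ => restr_incl n x
  diffInv := (restr n).differentiable.differentiableOn

theorem meas_flat_apply {U : Set (Euc n)} (hU : MeasurableSet U) {E : Set FinSeq}
    (hE : MeasurableSet E) : (flat n U hU).meas E = volume (U ∩ incl n ⁻¹' E) := by
  rw [meas_apply _ hE]
  simp only [flat]
  rw [jac_isometry]
  simp

/-! ### Gluing the volume measures of finitely many patches -/

/-- Finitely many patches of the same dimension have a common volume measure, carried by their
union. -/
theorem exists_glue (s : Finset (Patch k)) : ∃ ν : Measure FinSeq,
    (∀ P ∈ s, ν.restrict P.surface = P.meas) ∧ ν (⋃ P ∈ s, P.surface)ᶜ = 0 := by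
  classical
  induction s using Finset.induction_on with
  | empty => exact ⟨0, by simp, by simp⟩
  | insert P s _ ih =>
    obtain ⟨ν, h1, h2⟩ := ih
    set T := ⋃ Q ∈ s, Q.surface with hT
    have hTm : MeasurableSet T := s.measurableSet_biUnion fun Q _ => Q.measurableSet_surface
    have hνT : ν.restrict T = ν :=
      Measure.restrict_eq_self_of_ae_mem (by rw [ae_iff]; exact h2)
    -- on `P.surface ∩ T` the old measure is already the volume of `P`
    refine ⟨ν + P.meas.restrict Tᶜ, ?_, ?_⟩
    · intro Q hQ
      rw [Measure.restrict_add, Measure.restrict_restrict Q.measurableSet_surface]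
      rcases Finset.mem_insert.1 hQ with rfl | hQ
      · have hsw : (ν.restrict Q.surface).restrict T = (Q.meas).restrict T := by
          have h3 : ∀ R ∈ (s : Set (Patch k)),
              (ν.restrict Q.surface).restrict R.surface = (Q.meas).restrict R.surface := by
            intro R hR
            rw [Measure.restrict_restrict R.measurableSet_surface, Set.inter_comm,
              ← Measure.restrict_restrict Q.measurableSet_surface, h1 R hR, meas_restrict_comm]
          exact (Measure.restrict_biUnion_congr s.countable_toSet).2 h3
        rw [Measure.restrict_restrict hTm, Set.inter_comm,
          ← Measure.restrict_restrict Q.measurableSet_surface, hνT] at hsw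
        rw [hsw, Set.inter_comm, ← Measure.restrict_restrict hTm.compl, meas_restrict_surface]
        exact Measure.restrict_add_restrict_compl hTm
      · have : Q.surface ∩ Tᶜ = ∅ := by
          rw [← Set.sdiff_eq, Set.sdiff_eq_empty]
          exact Set.subset_biUnion_of_mem (u := fun Q : Patch k => Q.surface) hQ
        rw [this, Measure.restrict_empty, add_zero, h1 Q hQ]
    · rw [Measure.add_apply, Finset.set_biUnion_insert, Set.compl_union]
      have hz : ν (P.surfaceᶜ ∩ Tᶜ) = 0 := measure_mono_null Set.inter_subset_right h2
      have hz' : P.meas.restrict Tᶜ (P.surfaceᶜ ∩ Tᶜ) = 0 :=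
        nonpos_iff_eq_zero.1 ((Measure.restrict_apply_le _ _).trans
          (measure_mono_null Set.inter_subset_left P.meas_compl_surface).le)
      rw [hz, hz', add_zero]

/-- A chosen common volume measure of finitely many patches of the same dimension. -/
def glue (s : Finset (Patch k)) : Measure FinSeq := (exists_glue s).choose

theorem glue_restrict {s : Finset (Patch k)} {P : Patch k} (hP : P ∈ s) :
    (glue s).restrict P.surface = P.meas := (exists_glue s).choose_spec.1 P hP

theorem glue_compl (s : Finset (Patch k)) : glue s (⋃ P ∈ s, P.surface)ᶜ = 0 :=
  (exists_glue s).choose_spec.2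

theorem restrict_eq_glue (s : Finset (Patch k)) :
    (glue s).restrict (⋃ P ∈ s, P.surface) = glue s :=
  Measure.restrict_eq_self_of_ae_mem (by rw [ae_iff]; exact glue_compl s)

theorem glue_apply {s : Finset (Patch k)} {P : Patch k} (hP : P ∈ s) {E : Set FinSeq}
    (hE : E ⊆ P.surface) : glue s E = P.meas E := by
  rw [← glue_restrict hP, Measure.restrict_apply' P.measurableSet_surface,
    Set.inter_eq_left.2 hE]

theorem nullMeasurableSet_glue {s : Finset (Patch k)} {P : Patch k} (hP : P ∈ s)
    {B : Set (Euc k)} (hB : NullMeasurableSet B volume) (hBU : B ⊆ P.U) :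
    NullMeasurableSet (P.f '' B) (glue s) := by
  have h := P.nullMeasurableSet_image hB hBU
  rw [← glue_restrict hP] at h
  exact (nullMeasurableSet_restrict_of_subset (s := P.surface) (Set.image_mono hBU)).1 h

/-- A set that is null for every patch is null for the glued measure. -/
theorem glue_eq_zero {s : Finset (Patch k)} {E : Set FinSeq} (h : ∀ P ∈ s, P.meas E = 0) :
    glue s E = 0 := by
  have hsub : E ⊆ (⋃ P ∈ s, E ∩ P.surface) ∪ (⋃ P ∈ s, P.surface)ᶜ := by
    intro x hx
    by_cases hxs : x ∈ ⋃ P ∈ s, P.surface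
    · simp only [Set.mem_iUnion] at hxs
      obtain ⟨P, hP, hxP⟩ := hxs
      exact Or.inl (Set.mem_biUnion (x := P) hP ⟨hx, hxP⟩)
    · exact Or.inr hxs
  refine measure_mono_null hsub (measure_union_null ?_ (glue_compl s))
  refine (measure_biUnion_null_iff s.countable_toSet).2 fun P hP => ?_
  rw [glue_apply hP Set.inter_subset_right]
  exact measure_mono_null Set.inter_subset_left (h P hP)

theorem glue_univ_lt_top {s : Finset (Patch k)} (h : ∀ P ∈ s, P.meas Set.univ < ⊤) :
    glue s Set.univ < ⊤ := by
  rw [← restrict_eq_glue, Measure.restrict_apply_univ]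
  refine (measure_biUnion_finset_le _ _).trans_lt (ENNReal.sum_lt_top.2 fun P hP => ?_)
  rw [glue_apply hP subset_rfl]
  exact (measure_mono (Set.subset_univ _)).trans_lt (h P hP)

end Patch

/-! ### Smooth surfaces as patches, and their volume -/

variable {k N : ℕ}

namespace SmoothParam

theorem mapsTo (P : SmoothParam k N) : P.U ⊆ P.V := subset_closure.trans P.closure_subset

theorem continuousOn_fderiv (P : SmoothParam k N) : ContinuousOn (fderiv ℝ P.φ) P.V :=
  P.contDiffOn.continuousOn_fderiv_of_isOpen P.isOpen_V le_rfl

theorem differentiableAt (P : SmoothParam k N) {x : Euc k} (hx : x ∈ P.V) :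
    DifferentiableAt ℝ P.φ x :=
  (P.contDiffOn.differentiableOn one_ne_zero).differentiableAt (P.isOpen_V.mem_nhds hx)

/-- A parameterized smooth surface of `ℝᴺ`, as a patch in `ℝ^{<ω}`. -/
def toPatch (P : SmoothParam k N) : Patch k where
  f := fun x => incl N (P.φ x)
  f' := fun x => (inclL N).toContinuousLinearMap.comp (fderiv ℝ P.φ x)
  U := P.U
  inv := fun y => Function.invFunOn P.φ P.V (restr N y)
  measU := P.isOpen_U.measurableSet
  hasDeriv := fun x hx =>
    ((inclL N).toContinuousLinearMap.hasFDerivAt.comp x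
      (P.differentiableAt (P.mapsTo hx)).hasFDerivAt).hasFDerivWithinAt
  contDeriv := by
    have h : Continuous fun T : Euc k →L[ℝ] Euc N => (inclL N).toContinuousLinearMap.comp T := by
      fun_prop
    exact h.comp_continuousOn (P.continuousOn_fderiv.mono P.mapsTo)
  leftInv := fun x hx => by
    rw [restr_incl]
    exact P.injOn.leftInvOn_invFunOn (P.mapsTo hx)
  diffInv := by
    refine (P.contDiffOn_inv.differentiableOn one_ne_zero).comp
      (restr N).differentiable.differentiableOn ?_
    rintro _ ⟨x, hx, rfl⟩
    exact ⟨x, P.mapsTo hx, (restr_incl N _).symm⟩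

theorem toPatch_image (P : SmoothParam k N) (B : Set (Euc k)) :
    P.toPatch.f '' B = incl N '' (P.φ '' B) := by
  rw [Set.image_image]; rfl

theorem toPatch_surface (P : SmoothParam k N) : P.toPatch.surface = incl N '' P.surface :=
  P.toPatch_image P.U

theorem jac_toPatch (P : SmoothParam k N) (x : Euc k) :
    jac (P.toPatch.f' x) = Real.sqrt (P.gramMatrix x).det := by
  rw [gramMatrix]
  exact jac_isometry_comp (inclL N) (fderiv ℝ P.φ x)

theorem integrableOn_jac (P : SmoothParam k N) :
    IntegrableOn (fun x => Real.sqrt (P.gramMatrix x).det) P.U := by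
  have hc : IsCompact (closure P.U) := P.bounded_U.isCompact_closure
  have h : ContinuousOn (fun x => jac (fderiv ℝ P.φ x)) (closure P.U) :=
    continuous_jac.comp_continuousOn (P.continuousOn_fderiv.mono P.closure_subset)
  exact (h.integrableOn_compact hc).mono_set subset_closure

theorem paramVol_nonneg (P : SmoothParam k N) (B : Set (Euc k)) : 0 ≤ P.paramVol B :=
  integral_nonneg fun _ => Real.sqrt_nonneg _

theorem meas_toPatch_image (P : SmoothParam k N) {B : Set (Euc k)}
    (hB : NullMeasurableSet B volume) (hBU : B ⊆ P.U) :
    P.toPatch.meas (incl N '' (P.φ '' B)) = ENNReal.ofReal (P.paramVol B) := by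
  rw [← toPatch_image, P.toPatch.meas_image hB hBU, paramVol,
    ofReal_integral_eq_lintegral_ofReal (P.integrableOn_jac.mono_set hBU)
      (Eventually.of_forall fun _ => Real.sqrt_nonneg _)]
  simp only [jac_toPatch]

theorem meas_toPatch_univ_lt_top (P : SmoothParam k N) : P.toPatch.meas Set.univ < ⊤ := by
  rw [← P.toPatch.meas_restrict_surface, Measure.restrict_apply_univ, toPatch_surface, surface,
    P.meas_toPatch_image P.isOpen_U.measurableSet.nullMeasurableSet subset_rfl]
  exact ENNReal.ofReal_lt_top

end SmoothParam

/-- A measure that extends the volumes of all the surfaces involved computes `IsVol`. -/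
theorem glue_incl_image {s : Finset (Patch k)} {r : ℕ} (P : Fin r → SmoothParam k N)
    (hs : ∀ i, (P i).toPatch ∈ s) (B : Fin r → Set (Euc k))
    (hB : ∀ i, B i ⊆ (P i).U ∧ NullMeasurableSet (B i) volume)
    (hd : ∀ i j, i ≠ j → Disjoint ((P i).φ '' B i) ((P j).φ '' B j)) :
    Patch.glue s (incl N '' ⋃ i, (P i).φ '' B i) =
      ENNReal.ofReal (∑ i, (P i).paramVol (B i)) := by
  rw [Set.image_iUnion, measure_iUnion₀, tsum_fintype,
    ENNReal.ofReal_sum_of_nonneg fun i _ => (P i).paramVol_nonneg _]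
  · refine Finset.sum_congr rfl fun i _ => ?_
    rw [← (P i).meas_toPatch_image (hB i).2 (hB i).1]
    exact Patch.glue_apply (hs i) (by
      rw [SmoothParam.toPatch_surface]
      exact Set.image_mono (Set.image_mono (hB i).1))
  · intro i j hij
    exact (Set.disjoint_image_of_injective (incl_injective N) (hd i j hij)).aedisjoint
  · intro i
    rw [← SmoothParam.toPatch_image]
    exact Patch.nullMeasurableSet_glue (hs i) (hB i).2 (hB i).1

theorem IsVol.unique {A : Set (Euc N)} {v w : ℝ} (hv : IsVol k A v) (hw : IsVol k A w) :
    v = w := by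
  classical
  obtain ⟨r, P, B, hB, hd, hA, rfl⟩ := hv
  obtain ⟨r', Q, C, hC, hd', hA', rfl⟩ := hw
  set s : Finset (Patch k) := Finset.univ.image (fun i => (P i).toPatch) ∪
    Finset.univ.image (fun i => (Q i).toPatch) with hs
  have h1 := glue_incl_image P (s := s) (fun i => by simp [hs]) B hB hd
  have h2 := glue_incl_image Q (s := s) (fun i => by simp [hs]) C hC hd'
  rw [← hA] at h1
  rw [← hA', h1] at h2
  exact (ENNReal.ofReal_eq_ofReal_iff
    (Finset.sum_nonneg fun i _ => (P i).paramVol_nonneg _)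
    (Finset.sum_nonneg fun i _ => (Q i).paramVol_nonneg _)).1 h2

/-- A fragment of a piecewise smooth surface is split by taking from each piece what lies in no
earlier piece. -/
theorem IsPiecewiseFragment.exists_isVol {S A : Set (Euc N)} (h : IsPiecewiseFragment k S A) :
    ∃ v, IsVol k A v := by
  obtain ⟨hAS, r, P, rfl, hfr⟩ := h
  choose B hBU hBm hBA using hfr
  set E : Fin r → Set FinSeq := fun i => ⋃ j : Fin r, ⋃ _ : j < i, (P j).toPatch.surface with hE
  have hEm : ∀ i, MeasurableSet (E i) := fun i =>
    MeasurableSet.iUnion fun j => MeasurableSet.iUnion fun _ => (P j).toPatch.measurableSet_surface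
  set C : Fin r → Set (Euc k) := fun i => B i \ ((P i).U ∩ (P i).toPatch.f ⁻¹' E i) with hC
  have hmem : ∀ i x, x ∈ (P i).φ '' C i ↔
      x ∈ A ∧ x ∈ (P i).surface ∧ ∀ j, j < i → x ∉ (P j).surface := by
    intro i x
    have hEx : ∀ y, incl N y ∈ E i ↔ ∃ j, j < i ∧ y ∈ (P j).surface := by
      intro y
      simp only [hE, Set.mem_iUnion, SmoothParam.toPatch_surface,
        (incl_injective N).mem_set_image, exists_prop]
    constructor
    · rintro ⟨y, ⟨hy, hyn⟩, rfl⟩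
      have hyA : (P i).φ y ∈ A ∩ (P i).surface := by rw [hBA i]; exact ⟨y, hy, rfl⟩
      refine ⟨hyA.1, hyA.2, fun j hj hjs => hyn ⟨hBU i hy, (hEx _).2 ⟨j, hj, hjs⟩⟩⟩
    · rintro ⟨hxA, hxs, hxn⟩
      have : x ∈ (P i).φ '' B i := by rw [← hBA i]; exact ⟨hxA, hxs⟩
      obtain ⟨y, hy, rfl⟩ := this
      refine ⟨y, ⟨hy, fun hy' => ?_⟩, rfl⟩
      obtain ⟨j, hj, hjs⟩ := (hEx _).1 hy'.2
      exact hxn j hj hjs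
  refine ⟨_, r, P, C, fun i => ⟨Set.sdiff_subset.trans (hBU i), (hBm i).diff
    ((P i).toPatch.measurableSet_preimage (hEm i)).nullMeasurableSet⟩, ?_, ?_, rfl⟩
  · intro i j hij
    refine Set.disjoint_left.2 fun x hxi hxj => ?_
    obtain ⟨_, h1, h2⟩ := (hmem i x).1 hxi
    obtain ⟨_, h3, h4⟩ := (hmem j x).1 hxj
    rcases lt_or_gt_of_ne hij with h | h
    · exact h4 i h h1
    · exact h2 j h h3
  · ext x
    simp only [Set.mem_iUnion, hmem]
    constructor
    · intro hx
      obtain ⟨i, hi⟩ := Set.mem_iUnion.1 (hAS hx)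
      obtain ⟨j, hj, hmin⟩ := WellFounded.has_min (wellFounded_lt (α := Fin r))
        {i | x ∈ (P i).surface} ⟨i, hi⟩
      exact ⟨j, hx, hj, fun l hl hls => hmin l hls hl⟩
    · rintro ⟨i, hx, _⟩
      exact hx

/-! ### Finite samples of measures -/

section Sampling

variable {X : Type*}

/-- The number of points of `z` in `A`. -/
def count (z : Finset X) (A : Set X) : ℝ := ∑ x ∈ z, A.indicator (fun _ => (1 : ℝ)) x

open Classical in
theorem count_eq_card (z : Finset X) (A : Set X) : count z A = ((z.filter (· ∈ A)).card : ℝ) := by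
  rw [count, Finset.card_filter]
  push_cast
  exact Finset.sum_congr rfl fun x _ => by simp [Set.indicator_apply]

theorem count_nonneg (z : Finset X) (A : Set X) : 0 ≤ count z A := by
  classical
  rw [count_eq_card]; positivity

theorem count_le_card (z : Finset X) (A : Set X) : count z A ≤ z.card := by
  classical
  rw [count_eq_card]
  exact_mod_cast Finset.card_filter_le _ _

theorem one_le_count {z : Finset X} {A : Set X} {x : X} (hz : x ∈ z) (hA : x ∈ A) :
    1 ≤ count z A := by
  classical
  rw [count_eq_card]
  exact_mod_cast Finset.card_pos.2 ⟨x, Finset.mem_filter.2 ⟨hz, hA⟩⟩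

theorem count_mono {z w : Finset X} (h : z ⊆ w) (A : Set X) : count z A ≤ count w A := by
  classical
  rw [count_eq_card, count_eq_card]
  exact_mod_cast Finset.card_le_card (Finset.filter_subset_filter _ h)

theorem count_union_le [DecidableEq X] (z w : Finset X) (A : Set X) :
    count (z ∪ w) A ≤ count z A + count w A := by
  classical
  rw [count_eq_card, count_eq_card, count_eq_card, Finset.filter_union]
  exact_mod_cast Finset.card_union_le _ _

theorem count_iUnion {r : ℕ} (z : Finset X) {A : Fin r → Set X}
    (hd : ∀ i j, i ≠ j → Disjoint (A i) (A j)) :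
    count z (⋃ i, A i) = ∑ i, count z (A i) := by
  classical
  unfold count
  rw [Finset.sum_comm]
  refine Finset.sum_congr rfl fun x _ => ?_
  by_cases hx : x ∈ ⋃ i, A i
  · obtain ⟨i, hi⟩ := Set.mem_iUnion.1 hx
    rw [Set.indicator_of_mem hx, Finset.sum_eq_single i, Set.indicator_of_mem hi]
    · intro j _ hj
      exact Set.indicator_of_notMem (Set.disjoint_right.1 (hd j i hj) hi) _
    · simp
  · rw [Set.indicator_of_notMem hx, Finset.sum_eq_zero]
    exact fun i _ => Set.indicator_of_notMem (fun hi => hx (Set.mem_iUnion.2 ⟨i, hi⟩)) _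

variable [MeasurableSpace X]

/-- Finitely many sets are sampled by choosing, in each atom of the Boolean algebra that they
generate, a number of points proportional to its measure, rounded down. Rounding down makes the
sample avoid null sets. -/
theorem exists_sample (ν : Measure X) [IsFiniteMeasure ν] (hν : ∀ x, ν {x} = 0)
    (𝓔 : Finset (Set X)) : ∃ c : ℝ, ∀ K : ℕ, ∃ z : Finset X, ∀ E ∈ 𝓔, NullMeasurableSet E ν →
      K * ν.real E - c ≤ count z E ∧ count z E ≤ K * ν.real E := by
  classical
  set 𝓕 := 𝓔.filter (NullMeasurableSet · ν) with h𝓕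
  set atom : Finset (Set X) → Set X := fun T => {x | 𝓕.filter (x ∈ ·) = T} with hatom
  have hmeas : ∀ T ∈ 𝓕.powerset, NullMeasurableSet (atom T) ν := by
    intro T hT
    have : atom T = ⋂ E ∈ 𝓕, if E ∈ T then E else Eᶜ := by
      ext x
      simp only [hatom, Set.mem_ofPred_eq, Set.mem_iInter]
      constructor
      · rintro rfl E hE
        by_cases hx : x ∈ E <;> simp [hx, hE]
      · intro h
        ext E
        rw [Finset.mem_filter]
        constructor
        · rintro ⟨hE, hx⟩
          by_contra hn
          have := h E hE
          rw [if_neg hn] at this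
          exact this hx
        · intro hE
          have hEF := Finset.mem_powerset.1 hT hE
          have := h E hEF
          rw [if_pos hE] at this
          exact ⟨hEF, this⟩
    rw [this]
    refine Finset.nullMeasurableSet_biInter _ fun E hE => ?_
    have hEm := (Finset.mem_filter.1 hE).2
    split_ifs
    · exact hEm
    · exact hEm.compl
  have hdisj : ∀ T T', T ≠ T' → Disjoint (atom T) (atom T') := fun T T' h =>
    Set.disjoint_left.2 fun x hx hx' => h (hx.symm.trans hx')
  have hsum : ∀ E ∈ 𝓕, ν.real E = ∑ T ∈ 𝓕.powerset.filter (E ∈ ·), ν.real (atom T) := by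
    intro E hE
    rw [← measureReal_biUnion_finset₀]
    · congr 1
      ext x
      simp only [hatom, Set.mem_iUnion, Finset.mem_filter, Set.mem_ofPred_eq, exists_prop]
      constructor
      · intro hx
        exact ⟨_, ⟨Finset.mem_powerset.2 (Finset.filter_subset _ _),
          Finset.mem_filter.2 ⟨hE, hx⟩⟩, rfl⟩
      · rintro ⟨T, ⟨_, hT⟩, rfl⟩
        exact (Finset.mem_filter.1 hT).2
    · exact fun T _ T' _ h => (hdisj T T' h).aedisjoint
    · exact fun T hT => hmeas T (Finset.mem_filter.1 hT).1
  refine ⟨𝓕.powerset.card, fun K => ?_⟩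
  have hpick : ∀ T, ∃ w : Finset X, (w : Set X) ⊆ atom T ∧ w.card = ⌊K * ν.real (atom T)⌋₊ := by
    intro T
    by_cases h0 : ν (atom T) = 0
    · exact ⟨∅, by simp, by simp [measureReal_def, h0]⟩
    · have hinf : (atom T).Infinite := fun hf => h0 (by
        rw [← Set.biUnion_of_singleton (atom T)]
        exact (measure_biUnion_null_iff hf.countable).2 fun x _ => hν x)
      exact hinf.exists_subset_card_eq _
  choose w hw hcard using hpick
  refine ⟨𝓕.powerset.biUnion w, fun E hE hEm => ?_⟩
  have hEF : E ∈ 𝓕 := Finset.mem_filter.2 ⟨hE, hEm⟩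
  have hfilter : (𝓕.powerset.biUnion w).filter (· ∈ E) =
      (𝓕.powerset.filter (E ∈ ·)).biUnion w := by
    ext x
    simp only [Finset.mem_filter, Finset.mem_biUnion]
    constructor
    · rintro ⟨⟨T, hT, hx⟩, hxE⟩
      have hxT : 𝓕.filter (x ∈ ·) = T := hw T hx
      exact ⟨T, ⟨hT, hxT ▸ Finset.mem_filter.2 ⟨hEF, hxE⟩⟩, hx⟩
    · rintro ⟨T, ⟨hT, hET⟩, hx⟩
      have hxT : 𝓕.filter (x ∈ ·) = T := hw T hx
      rw [← hxT] at hET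
      exact ⟨⟨T, hT, hx⟩, (Finset.mem_filter.1 hET).2⟩
  have hc : count (𝓕.powerset.biUnion w) E =
      ∑ T ∈ 𝓕.powerset.filter (E ∈ ·), (⌊K * ν.real (atom T)⌋₊ : ℝ) := by
    rw [count_eq_card, hfilter, Finset.card_biUnion]
    · push_cast
      exact Finset.sum_congr rfl fun T _ => by rw [hcard]
    · intro T _ T' _ h
      exact Finset.disjoint_coe.1 ((hdisj T T' h).mono (hw T) (hw T'))
  rw [hc, hsum E hEF, Finset.mul_sum]
  constructor
  · have h1 : ∑ T ∈ 𝓕.powerset.filter (E ∈ ·), (K * ν.real (atom T) - 1) ≤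
        ∑ T ∈ 𝓕.powerset.filter (E ∈ ·), (⌊K * ν.real (atom T)⌋₊ : ℝ) :=
      Finset.sum_le_sum fun T _ => (Nat.sub_one_lt_floor _).le
    have h2 : ((𝓕.powerset.filter (E ∈ ·)).card : ℝ) ≤ 𝓕.powerset.card := by
      exact_mod_cast Finset.card_filter_le _ _
    rw [Finset.sum_sub_distrib, Finset.sum_const, nsmul_eq_mul, mul_one] at h1
    linarith
  · exact Finset.sum_le_sum fun T _ => Nat.floor_le (by positivity)

/-- Samples of `ν 1, …, ν D` are superposed, each so much larger than the preceding ones that these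
are negligible against it: a set that is null for all later measures is counted according to `ν d`,
on a scale `K` that depends on `d` only. -/
theorem exists_layered_sample (ν : ℕ → Measure X) (hfin : ∀ n, IsFiniteMeasure (ν n))
    (hν : ∀ n, 1 ≤ n → ∀ x, ν n {x} = 0) (𝓔 : Finset (Set X)) (F : Finset X) {θ : ℝ} (hθ : 0 < θ)
    (D : ℕ) : ∃ z : Finset X, F ⊆ z ∧ ∀ d, 1 ≤ d → d ≤ D → ∃ K : ℝ, 0 < K ∧ ∀ E ∈ 𝓔,
      NullMeasurableSet E (ν d) → (∀ n, d < n → n ≤ D → ν n E = 0) →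
      |count z E - K * (ν d).real E| ≤ θ * K := by
  classical
  induction D with
  | zero => exact ⟨F, subset_rfl, fun d h1 h2 => by omega⟩
  | succ D ih =>
    obtain ⟨z, hFz, hz⟩ := ih
    obtain ⟨c, hc⟩ := exists_sample (ν (D + 1)) (hν (D + 1) (by omega)) 𝓔
    -- `K` outweighs both the points of the earlier samples and the rounding error `c`
    obtain ⟨K, hK⟩ := exists_nat_gt (((z.card : ℝ) + |c|) / θ)
    rw [div_lt_iff₀ hθ] at hK
    have hKpos : (0 : ℝ) < K := by
      have : 0 < (K : ℝ) * θ := lt_of_le_of_lt (by positivity) hK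
      exact pos_of_mul_pos_left this hθ.le
    obtain ⟨w, hw⟩ := hc K
    refine ⟨z ∪ w, hFz.trans Finset.subset_union_left, fun d h1 h2 => ?_⟩
    rcases Nat.lt_or_ge D d with hd | hd
    · obtain rfl : d = D + 1 := by omega
      refine ⟨K, hKpos, fun E hE hEm _ => ?_⟩
      obtain ⟨h3, h4⟩ := hw E hE hEm
      have h5 := count_mono (Finset.subset_union_right : w ⊆ z ∪ w) E
      have h6 := count_union_le z w E
      have h7 := count_le_card z E
      have h8 := le_abs_self c
      have h9 : (0 : ℝ) ≤ z.card := by positivity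
      have h10 := abs_nonneg c
      rw [abs_le]
      constructor <;> linarith
    · obtain ⟨K', hK', h⟩ := hz d h1 hd
      refine ⟨K', hK', fun E hE hEm hnull => ?_⟩
      have h0 : ν (D + 1) E = 0 := hnull (D + 1) (by omega) le_rfl
      have h3 := (hw E hE (NullMeasurableSet.of_null h0)).2
      rw [measureReal_def, h0, ENNReal.toReal_zero, mul_zero] at h3
      have h4 : count (z ∪ w) E = count z E :=
        le_antisymm ((count_union_le z w E).trans (by linarith))
          (count_mono Finset.subset_union_left E)
      rw [h4]
      exact h E hE hEm fun n hn hn' => hnull n hn (by omega)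

end Sampling

/-! ### Finite sets that meet finitely many requirements -/

/-- The unit cube of `ℝⁿ`. -/
def cubeSet (n : ℕ) : Set (Euc n) := {x | ∀ i, x i ∈ Set.Icc (0 : ℝ) 1}

theorem unitCube_eq (n : ℕ) : unitCube n = incl n '' cubeSet n := rfl

theorem cubeSet_eq (n : ℕ) : cubeSet n =
    (WithLp.ofLp : Euc n → Fin n → ℝ) ⁻¹' Set.Icc (0 : Fin n → ℝ) 1 := by
  ext x
  simp [cubeSet, Pi.le_def, forall_and]

theorem measurableSet_cubeSet (n : ℕ) : MeasurableSet (cubeSet n) := by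
  rw [cubeSet_eq]
  exact (PiLp.volume_preserving_ofLp (Fin n)).measurable measurableSet_Icc

theorem volume_cubeSet (n : ℕ) : volume (cubeSet n) = 1 := by
  rw [cubeSet_eq, (PiLp.volume_preserving_ofLp (Fin n)).measure_preimage
    measurableSet_Icc.nullMeasurableSet, Real.volume_Icc_pi]
  simp

theorem measurable_incl (n : ℕ) : Measurable (incl n) := (continuous_incl n).measurable

/-- A fragment of a patch of finite volume. -/
structure Frag (n : ℕ) where
  patch : Patch n
  B : Set (Euc n)
  sub : B ⊆ patch.U
  meas : NullMeasurableSet B volume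
  fin : patch.meas Set.univ < ⊤

/-- The underlying subset of `ℝ^{<ω}`. -/
def Frag.set {n : ℕ} (p : Frag n) : Set FinSeq := p.patch.f '' p.B

/-- The volume of a fragment. -/
def Frag.vol {n : ℕ} (p : Frag n) : ℝ := p.patch.meas.real p.set

/-- The unit cube as a fragment. -/
def Frag.cube (n : ℕ) : Frag n where
  patch := Patch.flat n (cubeSet n) (measurableSet_cubeSet n)
  B := cubeSet n
  sub := subset_rfl
  meas := (measurableSet_cubeSet n).nullMeasurableSet
  fin := by
    rw [Patch.meas_flat_apply _ MeasurableSet.univ, Set.preimage_univ, Set.inter_univ,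
      volume_cubeSet]
    exact ENNReal.one_lt_top

theorem Frag.set_cube (n : ℕ) : (Frag.cube n).set = unitCube n := rfl

theorem measurableSet_unitCube (n : ℕ) : MeasurableSet (unitCube n) :=
  (Frag.cube n).patch.measurableSet_surface

theorem Frag.vol_cube (n : ℕ) : (Frag.cube n).vol = 1 := by
  rw [vol, measureReal_def, set_cube]
  simp only [cube]
  rw [Patch.meas_flat_apply _ (measurableSet_unitCube n), unitCube_eq,
    Set.preimage_image_eq _ (incl_injective n), Set.inter_self, volume_cubeSet, ENNReal.toReal_one]

/-- A middling Borel set together with a translation vector. -/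
structure MidTranslate where
  A : Set FinSeq
  x : FinSeq
  mid : Middling A
  meas : MeasurableSet A

/-- The translated set. -/
def MidTranslate.shift (m : MidTranslate) : Set FinSeq := (fun a => a + m.x) '' m.A

theorem MidTranslate.shift_eq (m : MidTranslate) : m.shift = (fun a => a - m.x) ⁻¹' m.A := by
  ext y
  constructor
  · rintro ⟨a, ha, rfl⟩
    simpa using ha
  · intro hy
    exact ⟨y - m.x, hy, sub_add_cancel _ _⟩

theorem MidTranslate.meas_shift (m : MidTranslate) : MeasurableSet m.shift := by
  rw [m.shift_eq]
  exact (continuous_id.sub continuous_const).measurable m.meas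

theorem MidTranslate.volume_shift (m : MidTranslate) {n : ℕ} (hx : m.x ∈ Set.range (incl n)) :
    volume (incl n ⁻¹' m.shift) = volume (incl n ⁻¹' m.A) := by
  obtain ⟨y, hy⟩ := hx
  have : incl n ⁻¹' m.shift = (fun v => v + (-y)) ⁻¹' (incl n ⁻¹' m.A) := by
    ext v
    simp only [m.shift_eq, Set.mem_preimage]
    rw [← hy, ← sub_eq_add_neg, ← inclL_apply, ← inclL_apply, ← inclL_apply, map_sub]
  rw [this, measure_preimage_add_right]

theorem eventually_mul_lt (c : ℝ) {e : ℝ} (he : 0 < e) : ∀ᶠ θ in 𝓝[>] (0 : ℝ), θ * c < e := by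
  have : Tendsto (fun θ : ℝ => θ * c) (𝓝[>] 0) (𝓝 (0 * c)) :=
    ((continuous_id.mul continuous_const).tendsto 0).mono_left nhdsWithin_le_nhds
  rw [zero_mul] at this
  exact this.eventually_lt_const he

/-- Two counts with a common scale `K` have the ratio of the corresponding measures. -/
theorem abs_sub_mul_le_of_scale {x y v K θ η : ℝ} (hK : 0 < K) (hv : 0 ≤ v)
    (hη : 0 < η) (hθ : θ * 2 < 1) (hθ' : θ * (2 * (1 + v)) < η)
    (hx : |x - K * v| ≤ θ * K) (hy : |y - K| ≤ θ * K) : |x - v * y| ≤ η * y := by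
  have hyK : K / 2 ≤ y := by
    have := (abs_le.1 hy).1
    nlinarith
  calc |x - v * y| = |(x - K * v) - v * (y - K)| := by ring_nf
    _ ≤ |x - K * v| + |v * (y - K)| := abs_sub _ _
    _ ≤ θ * K + v * (θ * K) := by
        rw [abs_mul, abs_of_nonneg hv]
        gcongr
    _ = (θ * (2 * (1 + v))) * (K / 2) := by ring
    _ ≤ η * (K / 2) := by gcongr
    _ ≤ η * y := by gcongr

/-- For finitely many fragments, countable sets and translations of middling sets, there is a finite
set that counts them with relative error `η`. In dimensions `n ≤ j` the sampled measure is the glued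
volume of the fragments and of the unit cube; in the dimensions where all the middling sets have
finite measure and contain the translation vectors, it is Lebesgue measure on a set that contains
the sections of the middling sets and of their translates. -/
theorem exists_good_finset (F : Finset FinSeq) (j : ℕ) (hj : 1 ≤ j) (Φ : ∀ n, Finset (Frag n))
    (𝒞 : Finset (Set FinSeq)) (h𝒞 : ∀ C ∈ 𝒞, C.Countable) (ℳ : Finset MidTranslate)
    {η : ℝ} (hη : 0 < η) :
    ∃ z : Finset FinSeq, F ⊆ z ∧
      (∀ n, 1 ≤ n → n ≤ j → ∀ p ∈ Φ n,
        |count z p.set - p.vol * count z (unitCube n)| ≤ η * count z (unitCube n)) ∧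
      (∀ C ∈ 𝒞, count z C ≤ η * count z (unitCube 1)) ∧
      ∀ m ∈ ℳ, 0 < count z m.A ∧ |count z m.shift - count z m.A| ≤ η * count z m.A := by
  classical
  obtain ⟨N₀, hN₀⟩ : ∃ N₀, ∀ n, N₀ ≤ n → j < n ∧ ∀ m ∈ ℳ, m.x ∈ Set.range (incl n) ∧
      volume (incl n ⁻¹' m.A) < ⊤ := by
    refine eventually_atTop.1 ((eventually_gt_atTop j).and ((Finset.eventually_all ℳ).2 ?_))
    intro m _
    refine Eventually.and ?_ ?_
    · obtain ⟨n, hn⟩ := exists_mem_range_incl m.x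
      exact eventually_atTop.2 ⟨n, fun i hi => range_incl_mono hi hn⟩
    · have := m.mid.1.compl_mem_cofinite
      rw [Nat.cofinite_eq_atTop] at this
      filter_upwards [this] with n hn
      exact not_not.1 hn
  have hpos : ∀ m : MidTranslate, ∃ n, N₀ ≤ n ∧ 0 < volume (incl n ⁻¹' m.A) := fun m => by
    obtain ⟨n, hn, hlt⟩ := m.mid.2.exists_gt N₀
    exact ⟨n, hlt.le, hn⟩
  choose q hqN hq using hpos
  -- in some dimension between `N₀` and `D` each middling set has positive measure
  set D := j + ∑ m ∈ ℳ, q m with hD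
  have hqD : ∀ m ∈ ℳ, q m ≤ D := fun m hm =>
    (Finset.single_le_sum (fun _ _ => Nat.zero_le _) hm).trans (Nat.le_add_left _ _)
  -- the last dimension up to `D` in which the section of a middling set is not null
  set t : MidTranslate → ℕ := fun m =>
    Nat.findGreatest (fun n => 0 < volume (incl n ⁻¹' m.A)) D with ht
  have htpos : ∀ m ∈ ℳ, 0 < volume (incl (t m) ⁻¹' m.A) := fun m hm =>
    Nat.findGreatest_spec (P := fun n => 0 < volume (incl n ⁻¹' m.A)) (hqD m hm) (hq m)
  have htN : ∀ m ∈ ℳ, N₀ ≤ t m := fun m hm =>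
    (hqN m).trans (Nat.le_findGreatest (hqD m hm) (hq m))
  have htD : ∀ m, t m ≤ D := fun m => Nat.findGreatest_le D
  have htmax : ∀ m n, t m < n → n ≤ D → volume (incl n ⁻¹' m.A) = 0 := fun m n h1 h2 =>
    nonpos_iff_eq_zero.1 (not_lt.1 (Nat.findGreatest_is_greatest h1 h2))
  set U : ∀ n, Set (Euc n) := fun n =>
    if N₀ ≤ n then ⋃ m ∈ ℳ, (incl n ⁻¹' m.A ∪ incl n ⁻¹' m.shift) else ∅ with hU
  have hUm : ∀ n, MeasurableSet (U n) := by
    intro n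
    rw [hU]
    dsimp only
    split_ifs
    · exact ℳ.measurableSet_biUnion fun m _ =>
        (measurable_incl n m.meas).union (measurable_incl n m.meas_shift)
    · exact MeasurableSet.empty
  have hUfin : ∀ n, volume (U n) < ⊤ := by
    intro n
    rw [hU]
    dsimp only
    split_ifs with h
    · refine (measure_biUnion_finset_le _ _).trans_lt (ENNReal.sum_lt_top.2 fun m hm => ?_)
      refine (measure_union_le _ _).trans_lt (ENNReal.add_lt_top.2 ?_)
      rw [m.volume_shift ((hN₀ n h).2 m hm).1]
      exact ⟨((hN₀ n h).2 m hm).2, ((hN₀ n h).2 m hm).2⟩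
    · simp
  set s : ∀ n, Finset (Patch n) := fun n =>
    insert (Frag.cube n).patch ((Φ n).image Frag.patch) with hs
  set ν : ℕ → Measure FinSeq := fun n =>
    if n ≤ j then Patch.glue (s n) else (Patch.flat n (U n) (hUm n)).meas with hν
  have hνj : ∀ n, n ≤ j → ν n = Patch.glue (s n) := fun n hn => by rw [hν]; exact if_pos hn
  have hνU : ∀ n, ¬ n ≤ j → ν n = (Patch.flat n (U n) (hUm n)).meas := fun n hn => by
    rw [hν]; exact if_neg hn
  have hfin : ∀ n, IsFiniteMeasure (ν n) := by
    intro n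
    refine ⟨?_⟩
    by_cases hn : n ≤ j
    · rw [hνj n hn]
      refine Patch.glue_univ_lt_top fun P hP => ?_
      rcases Finset.mem_insert.1 hP with rfl | hP
      · exact (Frag.cube n).fin
      · obtain ⟨p, _, rfl⟩ := Finset.mem_image.1 hP
        exact p.fin
    · rw [hνU n hn, Patch.meas_flat_apply _ MeasurableSet.univ, Set.preimage_univ, Set.inter_univ]
      exact hUfin n
  have hzero : ∀ n (E : Set FinSeq), (∀ P : Patch n, P.meas E = 0) → ν n E = 0 := by
    intro n E h
    by_cases hn : n ≤ j
    · rw [hνj n hn]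
      exact Patch.glue_eq_zero fun P _ => h P
    · rw [hνU n hn]
      exact h _
  have hpt : ∀ n, 1 ≤ n → ∀ x, ν n {x} = 0 := fun n hn x =>
    hzero n _ fun P => P.meas_singleton hn x
  -- hence sets of dimension `n ≤ j` are counted according to `ν n`
  have hlow : ∀ k n, k < n → ∀ Q : Patch k, ∀ E ⊆ Q.surface, ν n E = 0 := fun k n hkn Q E hE =>
    hzero n _ fun P => measure_mono_null hE (P.meas_surface_of_lt hkn Q)
  have hfrag : ∀ n, n ≤ j → ∀ p : Frag n, p.patch ∈ s n →
      NullMeasurableSet p.set (ν n) ∧ (ν n).real p.set = p.vol := by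
    intro n hn p hp
    rw [hνj n hn]
    refine ⟨Patch.nullMeasurableSet_glue hp p.meas p.sub, ?_⟩
    rw [Frag.vol, measureReal_def, measureReal_def,
      Patch.glue_apply hp (show p.set ⊆ p.patch.surface from Set.image_mono p.sub)]
  have hcub : ∀ n, n ≤ j → NullMeasurableSet (unitCube n) (ν n) ∧ (ν n).real (unitCube n) = 1 := by
    intro n hn
    have := hfrag n hn (Frag.cube n) (Finset.mem_insert_self _ _)
    rwa [Frag.vol_cube] at this
  have hmid : ∀ n, N₀ ≤ n → ∀ m ∈ ℳ, ν n m.A = volume (incl n ⁻¹' m.A) ∧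
      ν n m.shift = volume (incl n ⁻¹' m.A) := by
    intro n hn m hm
    have hsub : incl n ⁻¹' m.A ∪ incl n ⁻¹' m.shift ⊆ U n := by
      rw [hU]
      dsimp only
      rw [if_pos hn]
      exact Set.subset_biUnion_of_mem
        (u := fun m : MidTranslate => incl n ⁻¹' m.A ∪ incl n ⁻¹' m.shift) hm
    rw [hνU n (not_le.2 (hN₀ n hn).1), Patch.meas_flat_apply _ m.meas,
      Patch.meas_flat_apply _ m.meas_shift,
      Set.inter_eq_right.2 (Set.subset_union_left.trans hsub),
      Set.inter_eq_right.2 (Set.subset_union_right.trans hsub),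
      m.volume_shift ((hN₀ n hn).2 m hm).1]
    exact ⟨rfl, rfl⟩
  set a : MidTranslate → ℝ := fun m => (ν (t m)).real m.A with ha
  have hapos : ∀ m ∈ ℳ, 0 < a m := by
    intro m hm
    have h1 := (hmid _ (htN m hm) m hm).1
    rw [ha]
    dsimp only
    rw [measureReal_def, h1]
    exact ENNReal.toReal_pos (htpos m hm).ne' ((hN₀ _ (htN m hm)).2 m hm).2.ne
  obtain ⟨θ, hθ0, hθ1, hθC, hθP, hθM⟩ : ∃ θ : ℝ, 0 < θ ∧ θ * 2 < 1 ∧ θ * 2 < η ∧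
      (∀ n ∈ Finset.range (j + 1), ∀ p ∈ Φ n, θ * (2 * (1 + p.vol)) < η) ∧
      ∀ m ∈ ℳ, θ * 1 < a m ∧ θ * (2 + η) < η * a m := by
    refine Eventually.exists (f := 𝓝[>] (0 : ℝ)) ?_
    refine Eventually.and self_mem_nhdsWithin ((eventually_mul_lt _ one_pos).and
      ((eventually_mul_lt _ hη).and (Eventually.and ?_ ?_)))
    · exact (Finset.eventually_all _).2 fun n _ => (Finset.eventually_all _).2 fun p _ =>
        eventually_mul_lt _ hη
    · exact (Finset.eventually_all _).2 fun m hm => (eventually_mul_lt _ (hapos m hm)).and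
        (eventually_mul_lt _ (mul_pos hη (hapos m hm)))
  set 𝓔 : Finset (Set FinSeq) := (Finset.range (j + 1)).biUnion (fun n => (Φ n).image Frag.set) ∪
    (Finset.range (j + 1)).image unitCube ∪ 𝒞 ∪ ℳ.image MidTranslate.A ∪
    ℳ.image MidTranslate.shift with h𝓔
  obtain ⟨z, hFz, hz⟩ := exists_layered_sample ν hfin hpt 𝓔 F hθ0 D
  have hcube : ∀ n, n ≤ j → ∀ K : ℝ, (∀ E ∈ 𝓔, NullMeasurableSet E (ν n) →
      (∀ i, n < i → i ≤ D → ν i E = 0) → |count z E - K * (ν n).real E| ≤ θ * K) →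
      |count z (unitCube n) - K| ≤ θ * K := by
    intro n hnj K hE
    have h1 : unitCube n ∈ 𝓔 := by
      simp only [h𝓔, Finset.mem_union, Finset.mem_image, Finset.mem_range]
      exact Or.inl (Or.inl (Or.inl (Or.inr ⟨n, by omega, rfl⟩)))
    have h2 := hE _ h1 (hcub n hnj).1
      fun i hi _ => hlow n i hi (Frag.cube n).patch _ subset_rfl
    rwa [(hcub n hnj).2, mul_one] at h2
  refine ⟨z, hFz, ?_, ?_, ?_⟩
  · intro n hn1 hnj p hp
    obtain ⟨K, hK, hE⟩ := hz n hn1 (by omega)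
    have hnr : n ∈ Finset.range (j + 1) := Finset.mem_range.2 (by omega)
    have h1 : p.set ∈ 𝓔 := by
      simp only [h𝓔, Finset.mem_union, Finset.mem_biUnion, Finset.mem_image]
      exact Or.inl (Or.inl (Or.inl (Or.inl ⟨n, hnr, p, hp, rfl⟩)))
    have hpf := hfrag n hnj p (Finset.mem_insert_of_mem (Finset.mem_image_of_mem _ hp))
    have h2 := hE _ h1 hpf.1
      fun i hi _ => hlow n i hi p.patch _ (Set.image_mono p.sub)
    rw [hpf.2] at h2
    exact abs_sub_mul_le_of_scale hK measureReal_nonneg hη hθ1 (hθP n hnr p hp) h2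
      (hcube n hnj K hE)
  · intro C hC
    obtain ⟨K, hK, hE⟩ := hz 1 le_rfl (by omega)
    have h1 : C ∈ 𝓔 := by
      simp only [h𝓔, Finset.mem_union]
      exact Or.inl (Or.inl (Or.inr hC))
    have hCz : ∀ i, 1 ≤ i → ν i C = 0 := fun i hi => by
      rw [← Set.biUnion_of_singleton C]
      exact (measure_biUnion_null_iff (h𝒞 C hC)).2 fun x _ => hpt i hi x
    have h2 := hE C h1 (NullMeasurableSet.of_null (hCz 1 le_rfl)) fun i hi _ => hCz i hi.le
    rw [measureReal_def, hCz 1 le_rfl, ENNReal.toReal_zero] at h2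
    have h3 := abs_sub_mul_le_of_scale hK le_rfl hη hθ1 (by simpa using hθC) h2
      (hcube 1 hj K hE)
    rw [zero_mul, sub_zero] at h3
    exact (le_abs_self _).trans h3
  · intro m hm
    have htj : j < t m := (hN₀ _ (htN m hm)).1
    obtain ⟨K, hK, hE⟩ := hz (t m) (by omega) (htD m)
    have h1 : m.A ∈ 𝓔 := by
      simp only [h𝓔, Finset.mem_union, Finset.mem_image]
      exact Or.inl (Or.inr ⟨m, hm, rfl⟩)
    have h2 : m.shift ∈ 𝓔 := by
      simp only [h𝓔, Finset.mem_union, Finset.mem_image]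
      exact Or.inr ⟨m, hm, rfl⟩
    have h3 := hE _ h1 m.meas.nullMeasurableSet fun i hi hiD => by
      rw [(hmid i ((htN m hm).trans hi.le) m hm).1, htmax m i hi hiD]
    have h4 := hE _ h2 m.meas_shift.nullMeasurableSet fun i hi hiD => by
      rw [(hmid i ((htN m hm).trans hi.le) m hm).2, htmax m i hi hiD]
    have h5 : (ν (t m)).real m.shift = a m := by
      rw [ha]
      dsimp only
      rw [measureReal_def, measureReal_def, (hmid _ (htN m hm) m hm).1,
        (hmid _ (htN m hm) m hm).2]
    rw [h5] at h4
    change |count z m.A - K * a m| ≤ θ * K at h3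
    obtain ⟨h6, h7⟩ := hθM m hm
    have h8 : (a m - θ) * K ≤ count z m.A := by
      have := (abs_le.1 h3).1
      linarith
    have h9 : 0 < (a m - θ) * K := mul_pos (by linarith) hK
    refine ⟨h9.trans_le h8, ?_⟩
    calc |count z m.shift - count z m.A|
        = |(count z m.shift - K * a m) - (count z m.A - K * a m)| := by ring_nf
      _ ≤ θ * K + θ * K := (abs_sub _ _).trans (add_le_add h4 h3)
      _ = (θ * 2) * K := by ring
      _ ≤ (η * (a m - θ)) * K := mul_le_mul_of_nonneg_right (by linarith) hK.le
      _ = η * ((a m - θ) * K) := by ring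
      _ ≤ η * count z m.A := by gcongr

/-! ### The filter -/

/-- Finitely many requirements: points to be contained, fragments, countable sets and translations
of middling sets to be counted correctly, and a bound for the dimensions and the precision. -/
abbrev Config : Type :=
  Finset FinSeq × (∀ n, Finset (Frag n)) × Finset (Set FinSeq) × Finset MidTranslate × ℕ

/-- The image of the filter `atTop` on the directed set of configurations under a choice of finite
sets that meet the requirements. -/
theorem exists_filter : ∃ Γ : Filter (Finset FinSeq), IsFine Γ ∧
    (∀ n, 1 ≤ n → ∀ p : Frag n, ∀ η : ℝ, 0 < η → ∀ᶠ z in Γ,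
      |count z p.set - p.vol * count z (unitCube n)| ≤ η * count z (unitCube n)) ∧
    (∀ C : Set FinSeq, C.Countable → ∀ η : ℝ, 0 < η → ∀ᶠ z in Γ,
      count z C ≤ η * count z (unitCube 1)) ∧
    ∀ m : MidTranslate, ∀ η : ℝ, 0 < η → ∀ᶠ z in Γ,
      0 < count z m.A ∧ |count z m.shift - count z m.A| ≤ η * count z m.A := by
  classical
  have h : ∀ c : Config, _ := fun c =>
    exists_good_finset c.1 (c.2.2.2.2 + 1) (by omega) c.2.1
      (c.2.2.1.filter Set.Countable) (fun C hC => (Finset.mem_filter.1 hC).2) c.2.2.2.1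
      (Nat.one_div_pos_of_nat (α := ℝ) (n := c.2.2.2.2))
  choose ζ hpt hfr hct hmd using h
  have hprec : ∀ η : ℝ, 0 < η → ∃ j : ℕ, ∀ i, j ≤ i → 1 / ((i : ℝ) + 1) ≤ η := by
    intro η hη
    obtain ⟨j, hj⟩ := exists_nat_one_div_lt hη
    exact ⟨j, fun i hi => (Nat.one_div_le_one_div hi).trans hj.le⟩
  refine ⟨map ζ atTop, ⟨inferInstance, ?_⟩, ?_, ?_, ?_⟩
  · intro x
    refine mem_map.2 ?_
    filter_upwards [eventually_ge_atTop (({x}, fun _ => ∅, ∅, ∅, 0) : Config)] with c hc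
    exact hpt c (hc.1 (Finset.mem_singleton_self x))
  · intro n hn p η hη
    obtain ⟨j, hj⟩ := hprec η hη
    refine eventually_map.2 ?_
    filter_upwards [eventually_ge_atTop
      ((∅, Function.update (fun _ => ∅) n {p}, ∅, ∅, max j n) : Config)] with c hc
    have hp : p ∈ c.2.1 n := hc.2.1 n (by
      change p ∈ Function.update (fun n => (∅ : Finset (Frag n))) n {p} n
      rw [Function.update_self]
      exact Finset.mem_singleton_self p)
    have hcj : max j n ≤ c.2.2.2.2 := hc.2.2.2.2
    refine (hfr c n hn (by omega) p hp).trans ?_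
    exact mul_le_mul_of_nonneg_right (hj _ (by omega)) (count_nonneg _ _)
  · intro C hC η hη
    obtain ⟨j, hj⟩ := hprec η hη
    refine eventually_map.2 ?_
    filter_upwards [eventually_ge_atTop ((∅, fun _ => ∅, {C}, ∅, j) : Config)] with c hc
    refine (hct c C (Finset.mem_filter.2 ⟨hc.2.2.1 (Finset.mem_singleton_self C), hC⟩)).trans ?_
    exact mul_le_mul_of_nonneg_right (hj _ hc.2.2.2.2) (count_nonneg _ _)
  · intro m η hη
    obtain ⟨j, hj⟩ := hprec η hη
    refine eventually_map.2 ?_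
    filter_upwards [eventually_ge_atTop ((∅, fun _ => ∅, ∅, {m}, j) : Config)] with c hc
    obtain ⟨h1, h2⟩ := hmd c m (hc.2.2.2.1 (Finset.mem_singleton_self m))
    exact ⟨h1, h2.trans (mul_le_mul_of_nonneg_right (hj _ hc.2.2.2.2) (count_nonneg _ _))⟩

/-! ### Comparison of germs -/

theorem muchLess_coe {Z : Type*} {F : Filter Z} {f g : Z → ℝ} (hg : ∀ᶠ z in F, 0 < g z)
    (h : ∀ η : ℝ, 0 < η → ∀ᶠ z in F, |f z| ≤ η * g z) :
    MuchLess (f : F.Germ ℝ) (g : F.Germ ℝ) := by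
  refine ⟨Germ.liftRel_coe.2 hg, fun n => ?_⟩
  have hev : ∀ᶠ z in F, |(n : ℝ) * f z| < g z := by
    filter_upwards [hg, h (1 / (|(n : ℝ)| + 1)) (by positivity)] with z h0 h1
    rw [abs_mul]
    have h2 : |(n : ℝ)| / (|(n : ℝ)| + 1) < 1 := by
      rw [div_lt_one (by positivity)]
      exact lt_add_one _
    calc |(n : ℝ)| * |f z| ≤ |(n : ℝ)| * (1 / (|(n : ℝ)| + 1) * g z) := by gcongr
      _ = |(n : ℝ)| / (|(n : ℝ)| + 1) * g z := by ring
      _ < 1 * g z := by gcongr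
      _ = g z := one_mul _
  have hn : n • (f : F.Germ ℝ) = ((fun z => (n : ℝ) * f z : Z → ℝ) : F.Germ ℝ) := by
    rw [← Germ.coe_smul]
    congr 1
    ext z
    simp
  rw [hn]
  constructor
  · refine Germ.liftRel_coe.2 ?_
    filter_upwards [hev] with z hz
    exact (abs_lt.1 hz).1
  · refine Germ.liftRel_coe.2 ?_
    filter_upwards [hev] with z hz
    exact (abs_lt.1 hz).2

/-! ### Fragments in dimension zero and null fragments -/

theorem unitCube_zero : unitCube 0 = {0} := by
  ext x
  constructor
  · rintro ⟨y, -, rfl⟩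
    rw [Subsingleton.elim y 0]
    exact incl_zero 0
  · rintro rfl
    exact zero_mem_unitCube 0

theorem count_singleton {X : Type*} {z : Finset X} {x : X} (h : x ∈ z) : count z {x} = 1 := by
  classical
  rw [count_eq_card, Nat.cast_eq_one, Finset.card_eq_one]
  refine ⟨x, ?_⟩
  ext y
  simp only [Finset.mem_filter, Finset.mem_singleton, Set.mem_singleton_iff]
  grind

/-- In dimension zero a fragment is empty or a point, and volume is the number of points; fineness
alone makes the count exact. -/
theorem Frag.count_zero (p : Frag 0) : ∃ y : FinSeq, ∀ z : Finset FinSeq, 0 ∈ z → y ∈ z →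
    count z p.set = p.vol * count z (unitCube 0) := by
  rcases Set.eq_empty_or_nonempty p.B with h | ⟨b, hb⟩
  · refine ⟨0, fun z _ _ => ?_⟩
    have : p.set = ∅ := by rw [Frag.set, h, Set.image_empty]
    rw [Frag.vol, this, measureReal_empty, zero_mul, count]
    simp
  · refine ⟨p.patch.f b, fun z h0 hy => ?_⟩
    have hB : p.B = cubeSet 0 := by
      ext x
      rw [Subsingleton.elim x b]
      exact ⟨fun _ i => i.elim0, fun _ => hb⟩
    have hset : p.set = {p.patch.f b} := by
      rw [Frag.set, ← Set.image_singleton]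
      congr 1
      ext x
      rw [Subsingleton.elim x b]
      exact ⟨fun _ => rfl, fun _ => hb⟩
    have hjac : ∀ T : Euc 0 →L[ℝ] FinSeq, jac T = 1 := fun T => by
      rw [jac, Matrix.det_fin_zero, Real.sqrt_one]
    have hvol : p.vol = 1 := by
      rw [Frag.vol, measureReal_def, Frag.set, p.patch.meas_image p.meas p.sub, hB]
      simp only [hjac, ENNReal.ofReal_one, setLIntegral_one, volume_cubeSet, ENNReal.toReal_one]
    rw [hset, count_singleton hy, hvol, unitCube_zero, count_singleton h0, one_mul]

/-- The unit cube of `ℝⁱ` as a null fragment of higher dimension. -/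
theorem exists_frag_lowerCube {i j : ℕ} (h : i < j) :
    ∃ p : Frag j, p.set = unitCube i ∧ p.vol = 0 := by
  set E := incl j ⁻¹' unitCube i with hE
  have hEm : MeasurableSet E := measurable_incl j (measurableSet_unitCube i)
  set P := Patch.flat j E hEm with hP
  have hs : incl j '' E = unitCube i := by
    rw [hE, Set.image_preimage_eq_iff]
    rintro _ ⟨x, -, rfl⟩
    exact range_incl_mono h.le ⟨x, rfl⟩
  have hz : P.meas (unitCube i) = 0 := P.meas_surface_of_lt h (Frag.cube i).patch
  refine ⟨⟨P, E, subset_rfl, hEm.nullMeasurableSet, ?_⟩, hs, ?_⟩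
  · rw [← P.meas_restrict_surface, Measure.restrict_apply_univ]
    change P.meas (incl j '' E) < ⊤
    rw [hs, hz]
    exact ENNReal.zero_lt_top
  · change P.meas.real (incl j '' E) = 0
    rw [hs, measureReal_def, hz, ENNReal.toReal_zero]

/-- A fragment of a smooth surface of `ℝᴺ` as a fragment in `ℝ^{<ω}`. -/
def SmoothParam.toFrag {k N : ℕ} (P : SmoothParam k N) (B : Set (Euc k)) (hB : B ⊆ P.U)
    (hm : NullMeasurableSet B volume) : Frag k where
  patch := P.toPatch
  B := B
  sub := hB
  meas := hm
  fin := P.meas_toPatch_univ_lt_top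

theorem SmoothParam.set_toFrag {k N : ℕ} (P : SmoothParam k N) {B : Set (Euc k)} (hB : B ⊆ P.U)
    (hm : NullMeasurableSet B volume) : (P.toFrag B hB hm).set = incl N '' (P.φ '' B) :=
  P.toPatch_image B

theorem SmoothParam.vol_toFrag {k N : ℕ} (P : SmoothParam k N) {B : Set (Euc k)} (hB : B ⊆ P.U)
    (hm : NullMeasurableSet B volume) : (P.toFrag B hB hm).vol = P.paramVol B := by
  rw [Frag.vol, P.set_toFrag, measureReal_def]
  change (P.toPatch.meas _).toReal = _
  rw [P.meas_toPatch_image hm hB, ENNReal.toReal_ofReal (P.paramVol_nonneg B)]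

/-- The counting estimate for single fragments adds up over the pieces of a partition. -/
theorem IsVol.eventually_count {k N : ℕ} {Γ : Filter (Finset FinSeq)}
    (hΓ : ∀ p : Frag k, ∀ η : ℝ, 0 < η → ∀ᶠ z in Γ,
      |count z p.set - p.vol * count z (unitCube k)| ≤ η * count z (unitCube k))
    {A : Set (Euc N)} {v : ℝ} (hv : IsVol k A v) {η : ℝ} (hη : 0 < η) :
    ∀ᶠ z in Γ, |count z (incl N '' A) - v * count z (unitCube k)| ≤ η * count z (unitCube k) := by
  obtain ⟨r, P, B, hB, hd, rfl, rfl⟩ := hv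
  have h : ∀ᶠ z in Γ, ∀ i : Fin r, |count z (incl N '' ((P i).φ '' B i)) -
      (P i).paramVol (B i) * count z (unitCube k)| ≤ η / (r + 1) * count z (unitCube k) := by
    refine eventually_all.2 fun i => ?_
    have := hΓ ((P i).toFrag (B i) (hB i).1 (hB i).2) (η / (r + 1)) (by positivity)
    rwa [SmoothParam.set_toFrag, SmoothParam.vol_toFrag] at this
  filter_upwards [h] with z hz
  have hc := count_nonneg z (unitCube k)
  rw [Set.image_iUnion, count_iUnion z fun i j hij =>
    Set.disjoint_image_of_injective (incl_injective N) (hd i j hij), Finset.sum_mul,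
    ← Finset.sum_sub_distrib]
  calc _ ≤ ∑ i, |count z (incl N '' ((P i).φ '' B i)) -
        (P i).paramVol (B i) * count z (unitCube k)| := Finset.abs_sum_le_sum_abs _ _
    _ ≤ ∑ _i : Fin r, η / (r + 1) * count z (unitCube k) := Finset.sum_le_sum fun i _ => hz i
    _ = r / (r + 1) * (η * count z (unitCube k)) := by
        rw [Finset.sum_const, Finset.card_univ, Fintype.card_fin, nsmul_eq_mul]
        ring
    _ ≤ 1 * (η * count z (unitCube k)) := by
        gcongr
        rw [div_le_one (by positivity)]
        linarith
    _ = η * count z (unitCube k) := one_mul _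

end FilterIntegral

end

open FilterIntegral in
theorem mainTheorem5 :
    ∃ (Γ : Filter (Finset FilterIntegral.FinSeq)) (ε : ℕ → Γ.Germ ℝ),
      FilterIntegral.IsFine Γ ∧
      (∀ n, FilterIntegral.RPLt 0 (ε n) ∧ FilterIntegral.Infinitesimal (ε n)) ∧
      (∀ i j, i < j → FilterIntegral.MuchLess (ε i) (ε j)) ∧
      -- the unit cubes
      (∀ n, ε n = FilterIntegral.filterMeasure Γ (FilterIntegral.unitCube n)) ∧
      -- measurable fragments of surfaces; their volume `v` does not depend on the partition used
      (∀ (n N : ℕ) (S A : Set (EuclideanSpace ℝ (Fin N))),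
        FilterIntegral.IsPiecewiseFragment n S A →
        ∃ v : ℝ, (∀ w : ℝ, FilterIntegral.IsVol n A w ↔ w = v) ∧
          ∃ δ : Γ.Germ ℝ, FilterIntegral.MuchLess δ (ε n) ∧
            FilterIntegral.filterMeasure Γ (FilterIntegral.incl N '' A)
              = (v : Γ.Germ ℝ) * ε n + δ) ∧
      -- countable sets
      (∀ C : Set FilterIntegral.FinSeq, C.Countable →
        FilterIntegral.MuchLess (FilterIntegral.filterMeasure Γ C) (ε 1)) ∧
      -- middling Borel sets
      (∀ A : Set FilterIntegral.FinSeq, FilterIntegral.Middling A →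
        MeasurableSet[borel FilterIntegral.FinSeq] A →
        ∀ x : FilterIntegral.FinSeq,
          FilterIntegral.RatioClose
            (FilterIntegral.filterMeasure Γ ((fun a => a + x) '' A))
            (FilterIntegral.filterMeasure Γ A)) := by
  obtain ⟨Γ, hfine, hfrag, hcount, hmid⟩ := exists_filter
  have h0 : ∀ᶠ z in Γ, (0 : FinSeq) ∈ z := hfine.2 0
  have hcard : ∀ᶠ z in Γ, 0 < (z.card : ℝ) := by
    filter_upwards [h0] with z hz
    exact_mod_cast Finset.card_pos.2 ⟨0, hz⟩
  have hpos : ∀ n, ∀ᶠ z in Γ, 0 < count z (unitCube n) / (z.card : ℝ) := by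
    intro n
    filter_upwards [h0, hcard] with z hz hc
    exact div_pos (one_pos.trans_le (one_le_count hz (zero_mem_unitCube n))) hc
  have hdiv : ∀ (n : ℕ) (f : Finset FinSeq → ℝ),
      (∀ η : ℝ, 0 < η → ∀ᶠ z in Γ, |f z| ≤ η * count z (unitCube n)) →
      MuchLess ((fun z => f z / (z.card : ℝ) : Finset FinSeq → ℝ) : Γ.Germ ℝ)
        (filterMeasure Γ (unitCube n)) := by
    intro n f hf
    refine muchLess_coe (g := fun z => count z (unitCube n) / (z.card : ℝ)) (hpos n) fun η hη => ?_
    filter_upwards [hf η hη, hcard] with z hz hc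
    rw [abs_div, abs_of_pos hc, ← mul_div_assoc]
    gcongr
  have hlow : ∀ i j, i < j → ∀ η : ℝ, 0 < η → ∀ᶠ z in Γ,
      |count z (unitCube i)| ≤ η * count z (unitCube j) := by
    intro i j hij η hη
    obtain ⟨p, hs, hv⟩ := exists_frag_lowerCube hij
    have := hfrag j (by omega) p η hη
    rw [hs, hv] at this
    simpa using this
  have hfrag' : ∀ n, ∀ p : Frag n, ∀ η : ℝ, 0 < η → ∀ᶠ z in Γ,
      |count z p.set - p.vol * count z (unitCube n)| ≤ η * count z (unitCube n) := by
    intro n p η hη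
    rcases Nat.eq_zero_or_pos n with rfl | hn
    · obtain ⟨y, hy⟩ := p.count_zero
      filter_upwards [h0, hfine.2 y] with z hz hyz
      rw [hy z hz hyz, sub_self, abs_zero]
      exact mul_nonneg hη.le (count_nonneg _ _)
    · exact hfrag n hn p η hη
  refine ⟨Γ, fun n => filterMeasure Γ (unitCube n), hfine, fun n => ⟨?_, ?_⟩, ?_, fun n => rfl,
    ?_, ?_, ?_⟩
  · exact Germ.liftRel_coe.2 (hpos n)
  · refine muchLess_coe (f := fun z => count z (unitCube n) / (z.card : ℝ)) (g := fun _ => 1)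
      (Eventually.of_forall fun _ => one_pos) fun η hη => ?_
    filter_upwards [hlow n (n + 1) n.lt_succ_self η hη, hcard] with z hz hc
    rw [abs_div, abs_of_pos hc, div_le_iff₀ hc, mul_one]
    exact hz.trans (mul_le_mul_of_nonneg_left (count_le_card _ _) hη.le)
  · intro i j hij
    exact hdiv j _ (hlow i j hij)
  · intro n N S A hSA
    obtain ⟨v, hv⟩ := hSA.exists_isVol
    refine ⟨v, fun w => ⟨fun hw => hw.unique hv, fun h => h ▸ hv⟩,
      ((fun z => (count z (incl N '' A) - v * count z (unitCube n)) / (z.card : ℝ) :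
        Finset FinSeq → ℝ) : Γ.Germ ℝ), hdiv n _ fun η hη => hv.eventually_count (hfrag' n) hη, ?_⟩
    refine Germ.coe_eq.2 (Eventually.of_forall fun z => ?_)
    change count z (incl N '' A) / (z.card : ℝ) = v * (count z (unitCube n) / (z.card : ℝ)) +
      (count z (incl N '' A) - v * count z (unitCube n)) / (z.card : ℝ)
    ring
  · intro C hC
    refine hdiv 1 (fun z => count z C) fun η hη => ?_
    filter_upwards [hcount C hC η hη] with z hz
    rwa [abs_of_nonneg (count_nonneg _ _)]
  · intro A hA hAm x
    set m : MidTranslate := ⟨A, x, hA, hAm⟩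
    refine ⟨((fun z => (z.card : ℝ) / count z A : Finset FinSeq → ℝ) : Γ.Germ ℝ), ?_, ?_⟩
    · refine Germ.coe_eq.2 ?_
      filter_upwards [hmid m 1 one_pos, hcard] with z hz hc
      have hz0 : count z A ≠ 0 := hz.1.ne'
      change count z A / (z.card : ℝ) * ((z.card : ℝ) / count z A) = 1
      field_simp
    · refine muchLess_coe (f := fun z => count z m.shift / (z.card : ℝ) *
        ((z.card : ℝ) / count z A) - 1) (g := fun _ => 1)
        (Eventually.of_forall fun _ => one_pos) fun η hη => ?_
      filter_upwards [hmid m η hη, hcard] with z hz hc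
      have hz0 : 0 < count z A := hz.1
      have h1 : count z m.shift / (z.card : ℝ) * ((z.card : ℝ) / count z A) - 1 =
          (count z m.shift - count z A) / count z A := by
        field_simp
      rw [h1, abs_div, abs_of_pos hz0, mul_one, div_le_iff₀ hz0]
      exact hz.2
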